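/- Let $k$ be an algebraically closed field of arbitrary characteristic. Let $P$ be a $7$-dimensional $k$-vector space with a quadratic form $q$ and polar form $\beta_P(x,y)=q(x+y)-q(x)-q(y)$. Assume that $P$ is regular: either $\beta_P$ is nondegenerate, or $\mathrm{char}\,k=2$, the kernel of $\beta_P$ is one-dimensional, and $q$ is not identically zero on that kernel. Put $\mathrm{SO}(P)=\mathrm{O}(P)\cap \mathrm{SL}(P)$. Let $\mathrm{C}(P)$ be the Clifford algebra of $P$, $\mathrm{C}(P)_0$ its even part, and $x\mapsto x^{\mathrm t}$ the anti-involution of $\mathrm{C}(P)$ fixing $P$ pointwise. Let $\mathrm{Spin}(P)$ be the group of invertible elements $x\in \mathrm{C}(P)_0$ with $xPx^{-1}=P$ and $xx^{\mathrm t}=1$, and let $\pi_P:\mathrm{Spin}(P)\to \mathrm{SO}(P)$ be the homomorphism given by $\pi_P(x)(v)=xvx^{-1}$. An octonion $k$-algebra is an $8$-dimensional $k$-vector space $C$ with a quadratic form $q$ whose polar form is nondegenerate, a $k$-bilinear product satisfying $q(xy)=q(x)q(y)$, and a two-sided unit $e$. Its automorphism group $\mathrm{G}_2(C)$ preserves the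 space $e^{\perp}$ of pure octonions, the orthogonal of $e$ for the polar form. A $\mathrm{G}_2$-subgroup of $\mathrm{SO}(P)$ is a subgroup of the form $\{f^{-1}\circ \phi_{|e^\perp}\circ f : \phi\in \mathrm{G}_2(C)\}$ for some octonion $k$-algebra $C$ and some isometry $f$ from $P$ onto $e^{\perp}\subset C$. Let $W$ be a spinor module for $P$, i.e. a simple $\mathrm{C}(P)_0$-module, viewed as a representation of $\mathrm{Spin}(P)\subset \mathrm{C}(P)_0^\times$. Let $\Gamma\subset \mathrm{SO}(P)$ be a subgroup and $\widetilde\Gamma=\pi_P^{-1}(\Gamma)\subset \mathrm{Spin}(P)$. Assume that the $k[\widetilde\Gamma]$-module $W$ is semisimple. Then $\Gamma$ is contained in a $\mathrm{G}_2$-subgroup of $\mathrm{SO}(P)$ if and only if there is a group homomorphism $\beta:\widetilde\Gamma\to k^\times$ with $\beta^2=1$ which occurs in the restriction of $W$ to $\widetilde\Gamma$, i.e. such that there is a nonzero $w\in W$ with $\gamma w=\beta(\gamma)w$ for all $\gamma\in\widetilde\Gamma$. -/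

import Mathlib

universe u v w

namespace G2Spin

section QuadraticSpaces

variable {k : Type u} [Field k] {V : Type v} [AddCommGroup V] [Module k V]

/-- A quadratic space `(V, Q)` over `k` is regular if the polar form
`β(x, y) = Q (x + y) - Q x - Q y` is nondegenerate, or if `dim V` is odd, `k` has characteristic
`2`, the kernel of `β` is a line, and `Q` is not identically zero on that line. -/
def IsRegular (Q : QuadraticForm k V) : Prop :=
  Q.polarBilin.Nondegenerate ∨
    (Odd (Module.finrank k V) ∧ CharP k 2 ∧
      Module.finrank k (LinearMap.ker Q.polarBilin) = 1 ∧
      ∃ x ∈ LinearMap.ker Q.polarBilin, Q x ≠ 0)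

/-- The group `SO(V) = O(V) ∩ SL(V)` of proper isometries of a quadratic space, as a subgroup of
`GL(V)`. (This is the right definition of the proper isometries for regular spaces of odd
dimension in all characteristics; it is only used in dimension `7`.) -/
def SO (Q : QuadraticForm k V) : Subgroup (V ≃ₗ[k] V) where
  carrier := {g | (∀ x, Q (g x) = Q x) ∧ LinearEquiv.det g = 1}
  one_mem' := ⟨fun _ => rfl, map_one _⟩
  mul_mem' := by
    rintro a b ⟨ha, ha'⟩ ⟨hb, hb'⟩
    refine ⟨fun x => ?_, by rw [map_mul, ha', hb', one_mul]⟩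
    rw [LinearEquiv.mul_apply, ha, hb]
  inv_mem' := by
    rintro a ⟨ha, ha'⟩
    refine ⟨fun x => ?_, by rw [map_inv, ha', inv_one]⟩
    rw [← ha (a⁻¹ x), ← LinearEquiv.mul_apply, mul_inv_cancel]
    rfl

end QuadraticSpaces

section Spin

open CliffordAlgebra

variable {k : Type u} [Field k] {V : Type v} [AddCommGroup V] [Module k V]

/-- Over a field, `V` embeds in its Clifford algebra (in any characteristic). -/
theorem ι_injective (Q : QuadraticForm k V) : Function.Injective (ι Q) := by
  obtain ⟨B, hB⟩ := LinearMap.BilinMap.toQuadraticMap_surjective (0 - Q)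
  intro x y hxy
  have h := congrArg (changeForm hB) hxy
  rw [changeForm_ι, changeForm_ι] at h
  exact ExteriorAlgebra.ι_leftInverse.injective h

/-- The spin group `Spin(V)`: the even invertible elements `x` of the Clifford algebra which
normalize `V` and satisfy `x * xᵗ = 1`, where `xᵗ` is the anti-involution of the Clifford algebra
fixing `V` pointwise. -/
def Spin (Q : QuadraticForm k V) : Subgroup (CliffordAlgebra Q)ˣ where
  carrier := {x | (x : CliffordAlgebra Q) ∈ even Q ∧
    (x : CliffordAlgebra Q) * reverse (x : CliffordAlgebra Q) = 1 ∧
    (∀ m : V, ∃ m' : V, (x : CliffordAlgebra Q) * ι Q m * (↑x⁻¹ : CliffordAlgebra Q) = ι Q m') ∧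
    (∀ m : V, ∃ m' : V, (↑x⁻¹ : CliffordAlgebra Q) * ι Q m * (x : CliffordAlgebra Q) = ι Q m')}
  one_mem' := ⟨one_mem _, by simp, fun m => ⟨m, by simp⟩, fun m => ⟨m, by simp⟩⟩
  mul_mem' := by
    rintro a b ⟨ha, ha', ha₁, ha₂⟩ ⟨hb, hb', hb₁, hb₂⟩
    refine ⟨mul_mem ha hb, ?_, fun m => ?_, fun m => ?_⟩
    · rw [Units.val_mul, reverse.map_mul, mul_assoc, ← mul_assoc (b : CliffordAlgebra Q), hb',
        one_mul, ha']
    · obtain ⟨m₁, h₁⟩ := hb₁ m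
      obtain ⟨m₂, h₂⟩ := ha₁ m₁
      refine ⟨m₂, ?_⟩
      rw [← h₂, ← h₁, mul_inv_rev, Units.val_mul, Units.val_mul]
      simp only [mul_assoc]
    · obtain ⟨m₁, h₁⟩ := ha₂ m
      obtain ⟨m₂, h₂⟩ := hb₂ m₁
      refine ⟨m₂, ?_⟩
      rw [← h₂, ← h₁, mul_inv_rev, Units.val_mul, Units.val_mul]
      simp only [mul_assoc]
  inv_mem' := by
    rintro a ⟨ha, ha', ha₁, ha₂⟩
    have hinv : (↑a⁻¹ : CliffordAlgebra Q) = reverse (a : CliffordAlgebra Q) :=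
      Units.inv_eq_of_mul_eq_one_right ha'
    refine ⟨?_, ?_, ha₂, by simpa using ha₁⟩
    · rw [hinv]
      exact (reverse_mem_evenOdd_iff (Q := Q) (n := 0)).2 ha
    · rw [hinv, reverse_reverse, ← hinv, Units.inv_mul]

/-- Conjugation by an element of the spin group, as a linear endomorphism of `V`. -/
noncomputable def conjLin (Q : QuadraticForm k V) (x : Spin Q) : V →ₗ[k] V :=
  (LinearEquiv.ofInjective (ι Q) (ι_injective Q)).symm.toLinearMap ∘ₗ
    LinearMap.codRestrict (LinearMap.range (ι Q))
      (LinearMap.mulLeftRight k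
        ((x : (CliffordAlgebra Q)ˣ).val, (↑(x : (CliffordAlgebra Q)ˣ)⁻¹ : CliffordAlgebra Q)) ∘ₗ
          ι Q)
      (fun m => by
        obtain ⟨m', h⟩ := x.2.2.2.1 m
        exact ⟨m', by simp [← h]⟩)

theorem ι_conjLin (Q : QuadraticForm k V) (x : Spin Q) (m : V) :
    ι Q (conjLin Q x m) = (x : (CliffordAlgebra Q)ˣ).val * ι Q m *
      (↑(x : (CliffordAlgebra Q)ˣ)⁻¹ : CliffordAlgebra Q) := by
  have h := (LinearEquiv.ofInjective (ι Q) (ι_injective Q)).apply_symm_apply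
    (LinearMap.codRestrict (LinearMap.range (ι Q))
      (LinearMap.mulLeftRight k
        ((x : (CliffordAlgebra Q)ˣ).val, (↑(x : (CliffordAlgebra Q)ˣ)⁻¹ : CliffordAlgebra Q)) ∘ₗ
          ι Q)
      (fun m => by
        obtain ⟨m', h⟩ := x.2.2.2.1 m
        exact ⟨m', by simp [← h]⟩) m)
  have h' := congrArg Subtype.val h
  rw [LinearEquiv.ofInjective_apply] at h'
  simp [conjLin]

/-- The natural homomorphism `π_V : Spin(V) → GL(V)` (whose image lies in `SO(V)`), sending `x`
to `m ↦ x m x⁻¹`. -/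
noncomputable def proj (Q : QuadraticForm k V) : Spin Q →* (V ≃ₗ[k] V) :=
  (LinearMap.GeneralLinearGroup.generalLinearEquiv k V).toMonoidHom.comp
    (MonoidHom.toHomUnits
      { toFun := fun x => (conjLin Q x : Module.End k V)
        map_one' := LinearMap.ext fun m => ι_injective Q (by simp [ι_conjLin])
        map_mul' := fun x y => LinearMap.ext fun m => ι_injective Q (by
          simp [ι_conjLin, mul_assoc]) })

/-- Characterization of `proj`. -/
theorem ι_proj (Q : QuadraticForm k V) (x : Spin Q) (m : V) :
    ι Q (proj Q x m) = (x : (CliffordAlgebra Q)ˣ).val * ι Q m *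
      (↑(x : (CliffordAlgebra Q)ˣ)⁻¹ : CliffordAlgebra Q) :=
  ι_conjLin Q x m

/-- The linear representation of `Spin(V)` on a module `W` over the even Clifford algebra `C(V)₀`,
obtained by restriction along `Spin(V) ⊂ C(V)₀`. When `dim V` is odd and `W` is a simple
`C(V)₀`-module (a spinor module), this is the spin representation. -/
def spinRep (Q : QuadraticForm k V) (W : Type w) [AddCommGroup W] [Module k W] [Module (even Q) W]
    [IsScalarTower k (even Q) W] : Representation k (Spin Q) W where
  toFun x := Algebra.lsmul k k W (⟨((x : (CliffordAlgebra Q)ˣ) : CliffordAlgebra Q), x.2.1⟩ : even Q)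
  map_one' := map_one (Algebra.lsmul k k W)
  map_mul' x y := map_mul (Algebra.lsmul k k W)
    (⟨((x : (CliffordAlgebra Q)ˣ) : CliffordAlgebra Q), x.2.1⟩ : even Q)
    (⟨((y : (CliffordAlgebra Q)ˣ) : CliffordAlgebra Q), y.2.1⟩ : even Q)

end Spin

section Characters

variable {k : Type u} [Field k] {G : Type v} [Group G] {W : Type w} [AddCommGroup W] [Module k W]

/-- The character `β : G → kˣ` occurs in the representation `ρ`: some nonzero vector is an
eigenvector of `G` with character `β`. -/
def Occurs (β : G →* kˣ) (ρ : Representation k G W) : Prop :=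
  ∃ w : W, w ≠ 0 ∧ ∀ g : G, ρ g w = (β g : k) • w

end Characters

section Octonions

/-- An octonion algebra over `k`, with underlying space `C`: a nondegenerate quadratic space of
dimension `8` with a bilinear product that has a two-sided unit and for which the quadratic form is
multiplicative. -/
structure OctonionAlgebra (k : Type u) [Field k] (C : Type v) [AddCommGroup C] [Module k C] where
  /-- the quadratic form -/
  norm : QuadraticForm k C
  /-- the product -/
  mul : C →ₗ[k] C →ₗ[k] C
  /-- the unit element -/
  e : C
  finrank_eq : Module.finrank k C = 8
  nondegenerate : norm.polarBilin.Nondegenerate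
  norm_mul : ∀ x y, norm (mul x y) = norm x * norm y
  e_mul : ∀ x, mul e x = x
  mul_e : ∀ x, mul x e = x

namespace OctonionAlgebra

variable {k : Type u} [Field k] {C : Type v} [AddCommGroup C] [Module k C]

/-- The space of pure octonions: the orthogonal of the unit element for the polar form. -/
def pure (O : OctonionAlgebra k C) : Submodule k C :=
  LinearMap.ker (O.norm.polarBilin O.e)

/-- The automorphism group `G₂(C)` of an octonion algebra `C`: the linear bijections that preserve
the product (they automatically preserve the unit element and the quadratic form). -/
def G2 (O : OctonionAlgebra k C) : Subgroup (C ≃ₗ[k] C) where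
  carrier := {φ | ∀ x y, φ (O.mul x y) = O.mul (φ x) (φ y)}
  one_mem' := fun _ _ => rfl
  mul_mem' := by
    intro a b ha hb x y
    rw [LinearEquiv.mul_apply, hb, ha]
    rfl
  inv_mem' := by
    intro a ha x y
    apply a.injective
    rw [ha]
    simp only [← LinearEquiv.mul_apply, mul_inv_cancel]
    rfl

end OctonionAlgebra

variable {k : Type u} [Field k] {V : Type v} [AddCommGroup V] [Module k V]

/-- For a quadratic space `(V, Q)` of dimension `7`, a `G₂`-subgroup of `SO(V)` is the image of
`G₂(C)`, acting by restriction to the pure octonions, for some octonion algebra `C` and some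
isometry `f` from `V` onto the space of pure octonions of `C`. As every octonion algebra over `k`
is isomorphic to one on the space `k⁸`, it is enough to let `C` range over the universe of `k`. -/
def IsG2Subgroup (Q : QuadraticForm k V) (H : Subgroup (V ≃ₗ[k] V)) : Prop :=
  ∃ (C : Type u) (_ : AddCommGroup C) (_ : Module k C) (O : OctonionAlgebra k C)
    (f : Q.IsometryEquiv (O.norm.comp O.pure.subtype)),
    ∀ g : V ≃ₗ[k] V, g ∈ H ↔ ∃ φ ∈ O.G2, ∀ x : V, ((f (g x) : O.pure) : C) = φ (f x : O.pure)

end Octonions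

end G2Spin

/-!
The argument rests on two descriptions of the spinor module `W` of a regular quadratic space `P` of
dimension `7` over an algebraically closed field: it is an octonion algebra `C`, on which a vector
`v`, identified with a pure octonion, acts as `i` times the left multiplication by `v` (with `i² =
-1`); and it is, up to isomorphism, the only simple module of the even Clifford algebra, because
the latter is the full endomorphism algebra of `C`. The only property of `P` that is used is that
the form is nondefective, that is, does not vanish at a nonzero vector of the kernel of its polar
form. It leads, in every characteristic, to a basis of three hyperbolic pairs and one more vector,
so that `P` is the space of pure octonions of Zorn's algebra
(`Nondefective.nonempty_isometryEquiv_pure_splitOctonion`). There, products of an even number of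
left multiplications yield all matrix units (`eq_top_of_pure_mul_mem`), and the dimensions agree
(`two_mul_finrank_even`). For every octonion algebra the even Clifford algebra then acts through an
isomorphism (`bijective_even_octonion`), since each nonzero module contains the irreducible one
(`exists_injective_intertwiner`).

Suppose that `Γ` consists of automorphisms of `C`. If `x` in the spin group lies over the
automorphism `φ`, then `x` and `φ` intertwine the left multiplications in the same way, so `x = c
φ` on `C` for a scalar `c` by Schur's lemma, and `c² = 1` because both preserve the polar form of
the norm on pure octonions. As `φ` fixes the unit, `x` multiplies it by `c`
(`exists_sign_cliffordRep_e`), which gives the character.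

Conversely, let the preimage of `Γ` act on `w ≠ 0` through a character `β` with `β² = 1`. By
semisimplicity there is an equivariant projection to the line of `w`; the polar form of the norm is
nondegenerate and invariant under the spin group, so the projection is the pairing with a vector
`u`, which is again an eigenvector for `β` and pairs to `1` with `w`. One of `u`, `w`, `u + w` is
then not isotropic (`OctonionAlgebra.exists_eigenvector_norm_eq_one`), and it can be scaled to have
norm `1`. The isotope of `C` with this octonion as its unit has the operators `β(x) x` as
automorphisms (`proj_mem_g2Subgroup_isotope`). This shows that the image of the spin group element
lies in a `G₂`-subgroup, and it remains to know that `Γ` is in the image of the spin group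
(`exists_spin_proj_eq`). By the Skolem–Noether theorem an isometry `g` is given by conjugation with
an even unit on the even Clifford algebra, and on vectors this conjugation is `± g`. In
characteristic not `2` the sign is determined by the determinant: the line in the Clifford algebra
that corresponds to the top exterior power is central, and isometries act on it by their
determinant (`exists_map_eq_det_smul`, `det_eq_one_of_conj`).
-/

/-! ### Isometries and the top exterior power in the Clifford algebra -/

namespace G2Spin

open CliffordAlgebra

section Naturality

variable {k : Type*} [CommRing k] {V₁ V₂ : Type*} [AddCommGroup V₁] [Module k V₁]
  [AddCommGroup V₂] [Module k V₂] {Q₁ Q₁' : QuadraticForm k V₁} {Q₂ Q₂' : QuadraticForm k V₂}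

/-- Naturality of the contraction under isometries. -/
theorem contractLeft_map (f : Q₁ →qᵢ Q₂) (d : Module.Dual k V₂) (x : CliffordAlgebra Q₁) :
    contractLeft d (CliffordAlgebra.map f x) =
      CliffordAlgebra.map f (contractLeft (d ∘ₗ f.toLinearMap) x) := by
  induction x using CliffordAlgebra.left_induction with
  | algebraMap r => simp
  | add x y hx hy => simp only [map_add, hx, hy]
  | ι_mul x m hx =>
    rw [map_mul, map_apply_ι, contractLeft_ι_mul, contractLeft_ι_mul, hx]
    simp

/-- Naturality of the change of the quadratic form under maps preserving all forms involved. -/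
theorem changeForm_map {B₁ : LinearMap.BilinForm k V₁} {B₂ : LinearMap.BilinForm k V₂}
    (h₁ : B₁.toQuadraticMap = Q₁' - Q₁) (h₂ : B₂.toQuadraticMap = Q₂' - Q₂)
    (f : Q₁ →qᵢ Q₂) (f' : Q₁' →qᵢ Q₂') (hf : ∀ x, f x = f' x)
    (hB : ∀ x y, B₂ (f x) (f y) = B₁ x y) (x : CliffordAlgebra Q₁) :
    changeForm h₂ (CliffordAlgebra.map f x) = CliffordAlgebra.map f' (changeForm h₁ x) := by
  induction x using CliffordAlgebra.left_induction with
  | algebraMap r => simp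
  | add x y hx hy => simp only [map_add, hx, hy]
  | ι_mul x m hx =>
    have hd : (B₂ (f m)) ∘ₗ f'.toLinearMap = B₁ m := by
      ext y
      simpa [hf] using hB m y
    rw [map_mul, map_apply_ι, changeForm_ι_mul, changeForm_ι_mul, hx, map_sub, map_mul,
      map_apply_ι, contractLeft_map, hd, hf]

end Naturality

section TopElement

variable {k : Type*} [Field k] {V : Type*} [AddCommGroup V] [Module k V]

theorem ιMulti_basis_ne_zero {n : ℕ} (e : Module.Basis (Fin n) k V) :
    ExteriorAlgebra.ιMulti k n e ≠ 0 := by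
  intro h
  have h1 := ExteriorAlgebra.liftAlternating_apply_ιMulti (R := k) (N := k)
    (fun i => if h : n = i then h ▸ e.det else 0) e
  rw [h] at h1
  simp [e.det_self] at h1

/-- Alternating maps in as many variables as the dimension are multiples of the determinant. -/
theorem alternatingMap_comp_basis {N : Type*} [AddCommGroup N] [Module k N] {n : ℕ}
    (e : Module.Basis (Fin n) k V) (f : V [⋀^Fin n]→ₗ[k] N) (g : V →ₗ[k] V) :
    f (g ∘ e) = LinearMap.det g • f e := by
  have hf : f = (LinearMap.toSpanSingleton k N (f e)).compAlternatingMap e.det := by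
    refine e.ext_alternating fun v hv => ?_
    obtain ⟨σ, rfl⟩ : ∃ σ : Equiv.Perm (Fin n), (σ : Fin n → Fin n) = v :=
      ⟨Equiv.ofBijective v (Finite.injective_iff_bijective.mp hv), rfl⟩
    have := f.map_perm (e : Fin n → V) σ
    have h' := e.det.map_perm (e : Fin n → V) σ
    simp only [Function.comp_def] at this h'
    simp [this, h', e.det_self]
  conv_lhs => rw [hf]
  simp [Module.Basis.det_comp, e.det_self]

/-- Away from characteristic `2`, the Clifford algebra contains a line on which isometries act by
their determinant: the line corresponding to the top exterior power. -/
theorem exists_map_eq_det_smul [FiniteDimensional k V] (h2 : (2 : k) ≠ 0)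
    (Q : QuadraticForm k V) :
    ∃ z : CliffordAlgebra Q, z ≠ 0 ∧
      ∀ g : Q →qᵢ Q, CliffordAlgebra.map g z = LinearMap.det g.toLinearMap • z := by
  have : Invertible (2 : k) := invertibleOfNonzero h2
  let e := Module.finBasis k V
  have h := changeForm.associated_neg_proof (Q := Q)
  -- The bilinear form used for the change of form is minus half the polar form, so it
  -- is invariant.
  obtain ⟨z, hz⟩ := (changeFormEquiv h).surjective (ExteriorAlgebra.ιMulti k _ e)
  rw [changeFormEquiv_apply] at hz
  refine ⟨z, ?_, fun g => ?_⟩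
  · rintro rfl
    rw [map_zero] at hz
    exact ιMulti_basis_ne_zero e hz.symm
  · apply (changeFormEquiv h).injective
    let g' : (0 : QuadraticForm k V) →qᵢ (0 : QuadraticForm k V) :=
      { g.toLinearMap with map_app' := fun _ => rfl }
    rw [changeFormEquiv_apply, changeFormEquiv_apply,
      changeForm_map h h g g' (fun _ => rfl) (fun x y => ?_), map_smul, hz,
      ← alternatingMap_comp_basis]
    · exact ExteriorAlgebra.map_apply_ιMulti g.toLinearMap e
    · simp [QuadraticMap.associated_apply, ← map_add]

/-- An isometry that is conjugation by a unit on vectors is so on the whole Clifford algebra. -/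
theorem map_eq_conj {Q : QuadraticForm k V} (g : Q →qᵢ Q) (u : (CliffordAlgebra Q)ˣ)
    (h : ∀ v, ι Q (g v) * u = u * ι Q v) (x : CliffordAlgebra Q) :
    CliffordAlgebra.map g x * u = u * x := by
  induction x using CliffordAlgebra.induction with
  | algebraMap r => simp [Algebra.commutes]
  | ι v => simpa using h v
  | mul a b ha hb => rw [map_mul, mul_assoc, hb, ← mul_assoc, ha, mul_assoc]
  | add a b ha hb => rw [map_add, add_mul, mul_add, ha, hb]

/-- A vector on which the quadratic form does not vanish, as a unit of the Clifford algebra. -/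
noncomputable def ιUnit (Q : QuadraticForm k V) (v : V) (hv : Q v ≠ 0) : (CliffordAlgebra Q)ˣ where
  val := ι Q v
  inv := (Q v)⁻¹ • ι Q v
  val_inv := by
    rw [mul_smul_comm, ι_sq_scalar, Algebra.smul_def, ← map_mul, inv_mul_cancel₀ hv, map_one]
  inv_val := by
    rw [smul_mul_assoc, ι_sq_scalar, Algebra.smul_def, ← map_mul, inv_mul_cancel₀ hv, map_one]

/-- Conjugation by the vector `v` in the Clifford algebra: minus the reflection in `v`. -/
noncomputable def conjVector (Q : QuadraticForm k V) (v : V) (hv : Q v ≠ 0) : Q →qᵢ Q where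
  toLinearMap := -LinearMap.transvection (-(Q v)⁻¹ • Q.polarBilin v) v
  map_app' w := by
    have h := QuadraticMap.map_add Q (((Q v)⁻¹ * QuadraticMap.polar Q v w) • v) (-w)
    simp only [QuadraticMap.map_neg, QuadraticMap.polar_neg_right, QuadraticMap.map_smul,
      QuadraticMap.polar_smul_left, smul_eq_mul] at h
    simp [LinearMap.transvection.apply]
    rw [h]
    field_simp
    ring

theorem ι_conjVector_mul (Q : QuadraticForm k V) (v : V) (hv : Q v ≠ 0) (w : V) :
    ι Q (conjVector Q v hv w) * ιUnit Q v hv = ιUnit Q v hv * ι Q w := by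
  have h : conjVector Q v hv w = ((Q v)⁻¹ * QuadraticMap.polar Q v w) • v - w := by
    change -LinearMap.transvection (-(Q v)⁻¹ • Q.polarBilin v) v w = _
    simp [LinearMap.transvection.apply, sub_eq_add_neg]
  change _ * ι Q v = ι Q v * _
  rw [h, map_sub, map_smul, sub_mul, smul_mul_assoc, ι_sq_scalar, ι_mul_ι_comm v w,
    Algebra.smul_def, ← map_mul]
  congr 2
  field_simp

theorem det_conjVector [FiniteDimensional k V] (hV : Odd (Module.finrank k V))
    (Q : QuadraticForm k V) (v : V) (hv : Q v ≠ 0) :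
    LinearMap.det (conjVector Q v hv).toLinearMap = 1 := by
  change LinearMap.det (-LinearMap.transvection (-(Q v)⁻¹ • Q.polarBilin v) v) = 1
  rw [← neg_one_smul k, LinearMap.det_smul, hV.neg_one_pow, LinearMap.transvection.det]
  simp [QuadraticMap.polar_self]
  field_simp
  norm_num

/-- Away from characteristic `2` and in odd dimension, conjugation by a unit of the Clifford algebra
that normalizes the vectors has determinant `1` on them: the line on which isometries act by their
determinant is central. -/
theorem det_eq_one_of_conj [FiniteDimensional k V] (hV : Odd (Module.finrank k V))
    (h2 : (2 : k) ≠ 0) (Q : QuadraticForm k V) (y : V) (hy : Q y ≠ 0) (g : Q →qᵢ Q)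
    (u : (CliffordAlgebra Q)ˣ) (h : ∀ v, ι Q (g v) * u = u * ι Q v) :
    LinearMap.det g.toLinearMap = 1 := by
  obtain ⟨z, hz0, hz⟩ := exists_map_eq_det_smul h2 Q
  have haniso : ∀ v, Q v ≠ 0 → Commute z (ι Q v) := by
    intro v hv
    have := map_eq_conj (conjVector Q v hv) (ιUnit Q v hv) (ι_conjVector_mul Q v hv) z
    rw [hz, det_conjVector hV, one_smul] at this
    exact this
  have hall : ∀ v, Commute z (ι Q v) := by
    intro v
    by_cases hv : Q v = 0
    · have h1 := QuadraticMap.map_add Q v y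
      have h3 := QuadraticMap.map_add Q v (-y)
      rw [← sub_eq_add_neg, QuadraticMap.map_neg, QuadraticMap.polar_neg_right] at h3
      by_cases hvy : Q (v + y) = 0
      -- `v + y` and `v - y` cannot both be isotropic, as `Q (v + y) + Q (v - y) = 2 * Q y`.
      · have : Q (v - y) ≠ 0 := by
          intro hvy'
          rw [hvy'] at h3
          rw [hvy] at h1
          apply mul_ne_zero h2 hy
          linear_combination -h1 - h3 - 2 * hv
        simpa using (haniso _ this).add_right (haniso _ hy)
      · simpa using (haniso _ hvy).sub_right (haniso _ hy)
    · exact haniso v hv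
  have hcomm : ∀ x : CliffordAlgebra Q, Commute z x := by
    intro x
    induction x using CliffordAlgebra.induction with
    | algebraMap r => exact (Algebra.commutes r z).symm
    | ι v => exact hall v
    | mul a b ha hb => exact ha.mul_right hb
    | add a b ha hb => exact ha.add_right hb
  have h3 := map_eq_conj g u h z
  rw [hz, ← (hcomm u).eq, Units.mul_left_inj] at h3
  have h4 : (LinearMap.det g.toLinearMap - 1) • z = 0 := by rw [sub_smul, h3, one_smul, sub_self]
  exact sub_eq_zero.mp ((smul_eq_zero.mp h4).resolve_right hz0)

end TopElement
end G2Spin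

/-! ### Octonion algebras and their Clifford representation -/

namespace G2Spin

open CliffordAlgebra

namespace OctonionAlgebra

section Basic

variable {k : Type*} [Field k] {C : Type*} [AddCommGroup C] [Module k C]

theorem finiteDimensional (O : OctonionAlgebra k C) : FiniteDimensional k C :=
  Module.finite_of_finrank_pos (by rw [O.finrank_eq]; norm_num)

theorem nontrivial (O : OctonionAlgebra k C) : Nontrivial C :=
  Module.nontrivial_of_finrank_pos (R := k) (by rw [O.finrank_eq]; norm_num)

variable (O : OctonionAlgebra k C)

theorem e_ne_zero : O.e ≠ 0 := by
  intro he
  have := O.nontrivial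
  obtain ⟨x, hx⟩ := exists_ne (0 : C)
  apply hx
  rw [← O.e_mul x, he, map_zero, LinearMap.zero_apply]

theorem eq_of_polar_eq {x y : C}
    (h : ∀ z, QuadraticMap.polar O.norm x z = QuadraticMap.polar O.norm y z) : x = y := by
  refine sub_eq_zero.mp (O.nondegenerate.1 _ fun z => ?_)
  simp [h]

theorem polar_mul_left (x y z : C) : QuadraticMap.polar O.norm (O.mul x y) (O.mul x z) =
    O.norm x * QuadraticMap.polar O.norm y z := by
  simp only [QuadraticMap.polar, ← map_add, O.norm_mul]
  ring

theorem polar_mul_right (x y z : C) : QuadraticMap.polar O.norm (O.mul x z) (O.mul y z) =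
    QuadraticMap.polar O.norm x y * O.norm z := by
  simp only [QuadraticMap.polar, ← map_add, ← LinearMap.add_apply, O.norm_mul]
  ring

theorem polar_mul_add_polar_mul (x y z w : C) :
    QuadraticMap.polar O.norm (O.mul x y) (O.mul z w) +
      QuadraticMap.polar O.norm (O.mul x w) (O.mul z y) =
    QuadraticMap.polar O.norm x z * QuadraticMap.polar O.norm y w := by
  have h := O.polar_mul_left (x + z) y w
  have hx := O.polar_mul_left x y w
  have hz := O.polar_mul_left z y w
  simp only [map_add, LinearMap.add_apply, QuadraticMap.polar_add_left,
    QuadraticMap.polar_add_right] at h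
  rw [QuadraticMap.map_add O.norm x z, hx, hz,
    QuadraticMap.polar_comm O.norm (O.mul z y) (O.mul x w)] at h
  linear_combination h

/-- Left multiplication by a pure octonion is skew for the polar form. -/
theorem polar_pure_mul (x : O.pure) (y w : C) :
    QuadraticMap.polar O.norm (O.mul x y) w = -QuadraticMap.polar O.norm y (O.mul x w) := by
  have h := O.polar_mul_add_polar_mul x y O.e w
  have hx : QuadraticMap.polar O.norm O.e x = 0 := x.2
  rw [QuadraticMap.polar_comm O.norm x O.e, hx, O.e_mul, O.e_mul,
    QuadraticMap.polar_comm O.norm (O.mul x w)] at h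
  linear_combination h

theorem pure_mul_pure_mul (x : O.pure) (y : C) :
    O.mul x (O.mul x y) = -(O.norm x • y) := by
  refine O.eq_of_polar_eq fun z => ?_
  rw [O.polar_pure_mul, O.polar_mul_left]
  simp

end Basic

section Representation

variable {k : Type*} [Field k] {C : Type*} [AddCommGroup C] [Module k C]
  (O : OctonionAlgebra k C) {V : Type*} [AddCommGroup V] [Module k V] {Q : QuadraticForm k V}
  (f : Q →qᵢ O.norm.comp O.pure.subtype)

/-- The representation of the Clifford algebra on an octonion algebra `C` in which a vector
`v`, identified with a pure octonion, acts as `i` times the left multiplication by `v`, where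
`i² = -1`. -/
noncomputable def cliffordRep {i : k} (hi : i ^ 2 = -1) : CliffordAlgebra Q →ₐ[k] Module.End k C :=
  CliffordAlgebra.lift Q ⟨i • (O.mul ∘ₗ O.pure.subtype ∘ₗ f.toLinearMap), fun v => by
    ext y
    have h : O.norm (f v : O.pure) = Q v := f.map_app v
    have h' := O.pure_mul_pure_mul (f v) y
    rw [h] at h'
    change i • O.mul (f v : O.pure) (i • O.mul (f v : O.pure) y) = Q v • y
    rw [map_smul, smul_smul, ← pow_two, hi, h', neg_one_smul, neg_neg]⟩

theorem cliffordRep_ι {i : k} (hi : i ^ 2 = -1) (v : V) (y : C) :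
    O.cliffordRep f hi (ι Q v) y = i • O.mul (f v : O.pure) y := by
  simp [cliffordRep]

/-- The adjoint of the action of `x` for the polar form of the norm is the action of the image of
`x` under the anti-involution that is `-1` on vectors. -/
theorem polar_cliffordRep {i : k} (hi : i ^ 2 = -1) (x : CliffordAlgebra Q) (y z : C) :
    QuadraticMap.polar O.norm (O.cliffordRep f hi x y) z =
      QuadraticMap.polar O.norm y (O.cliffordRep f hi (involute (reverse x)) z) := by
  induction x using CliffordAlgebra.induction generalizing y z with
  | algebraMap r => simp
  | ι v => simp [cliffordRep_ι, polar_pure_mul]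
  | mul a b ha hb => simp [reverse.map_mul, ha, hb]
  | add a b ha hb => simp [ha, hb]

/-- An even element `x` with `xᵗ x = 1` preserves the polar form. -/
theorem polar_cliffordRep_of_even {i : k} (hi : i ^ 2 = -1) {x : CliffordAlgebra Q}
    (hx : x ∈ even Q) (hx' : reverse x * x = 1) (y z : C) :
    QuadraticMap.polar O.norm (O.cliffordRep f hi x y) (O.cliffordRep f hi x z) =
      QuadraticMap.polar O.norm y z := by
  rw [polar_cliffordRep, involute_eq_of_mem_even
    ((reverse_mem_evenOdd_iff (Q := Q) (n := 0)).2 hx), ← Module.End.mul_apply, ← map_mul, hx']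
  simp

end Representation

end OctonionAlgebra

section Split

variable (k : Type*) [Field k]

/-- A bilinear form whose associated quadratic form is the norm of the split octonions. -/
def splitForm : LinearMap.BilinForm k (Fin 8 → k) :=
  LinearMap.mk₂ k (fun x y => x 0 * y 7 - x 1 * y 4 - x 2 * y 5 - x 3 * y 6)
    (by intros; simp; ring) (by intros; simp; ring) (by intros; simp; ring)
    (by intros; simp; ring)

theorem ext_fin_eight {α : Type*} {x y : Fin 8 → α} (h0 : x 0 = y 0) (h1 : x 1 = y 1)
    (h2 : x 2 = y 2) (h3 : x 3 = y 3) (h4 : x 4 = y 4) (h5 : x 5 = y 5) (h6 : x 6 = y 6) (h7 : x 7 = y 7) :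
    x = y := by
  ext j
  fin_cases j <;> assumption

variable {k} in
/-- The product of Zorn's vector matrices: `(x₀, …, x₇)` stands for the matrix with diagonal
entries `x₀`, `x₇` and off-diagonal entries the vectors `(x₁, x₂, x₃)`, `(x₄, x₅, x₆)`. -/
def zornMul (x y : Fin 8 → k) : Fin 8 → k :=
  ![x 0 * y 0 + x 1 * y 4 + x 2 * y 5 + x 3 * y 6,
    x 0 * y 1 + y 7 * x 1 - (x 5 * y 6 - x 6 * y 5),
    x 0 * y 2 + y 7 * x 2 - (x 6 * y 4 - x 4 * y 6),
    x 0 * y 3 + y 7 * x 3 - (x 4 * y 5 - x 5 * y 4),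
    y 0 * x 4 + x 7 * y 4 + (x 2 * y 3 - x 3 * y 2),
    y 0 * x 5 + x 7 * y 5 + (x 3 * y 1 - x 1 * y 3),
    y 0 * x 6 + x 7 * y 6 + (x 1 * y 2 - x 2 * y 1),
    x 7 * y 7 + x 4 * y 1 + x 5 * y 2 + x 6 * y 3]

theorem zornMul_add_left (x y z : Fin 8 → k) :
    zornMul (x + y) z = zornMul x z + zornMul y z := by
  apply ext_fin_eight <;> simp [zornMul] <;> ring

theorem zornMul_smul_left (c : k) (x y : Fin 8 → k) :
    zornMul (c • x) y = c • zornMul x y := by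
  apply ext_fin_eight <;> simp [zornMul] <;> ring

theorem zornMul_add_right (x y z : Fin 8 → k) :
    zornMul x (y + z) = zornMul x y + zornMul x z := by
  apply ext_fin_eight <;> simp [zornMul] <;> ring

theorem zornMul_smul_right (c : k) (x y : Fin 8 → k) :
    zornMul x (c • y) = c • zornMul x y := by
  apply ext_fin_eight <;> simp [zornMul] <;> ring

/-- The product of Zorn's vector matrices as a bilinear map. -/
def splitMul : (Fin 8 → k) →ₗ[k] (Fin 8 → k) →ₗ[k] (Fin 8 → k) :=
  LinearMap.mk₂ k zornMul (zornMul_add_left k) (zornMul_smul_left k) (zornMul_add_right k)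
    (zornMul_smul_right k)

/-- The split octonion algebra, as the algebra of Zorn's vector matrices. -/
def splitOctonion : OctonionAlgebra k (Fin 8 → k) where
  norm := (splitForm k).toQuadraticMap
  mul := splitMul k
  e := ![1, 0, 0, 0, 0, 0, 0, 1]
  finrank_eq := by simp
  nondegenerate := by
    have h : ∀ x, (∀ y, QuadraticMap.polar (splitForm k).toQuadraticMap x y = 0) → x = 0 := by
      intro x hx
      simp only [LinearMap.BilinMap.polar_toQuadraticMap, splitForm, LinearMap.mk₂_apply] at hx
      ext j
      fin_cases j
      · simpa using hx (Pi.single 7 1)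
      · simpa using hx (Pi.single 4 1)
      · simpa using hx (Pi.single 5 1)
      · simpa using hx (Pi.single 6 1)
      · simpa using hx (Pi.single 1 1)
      · simpa using hx (Pi.single 2 1)
      · simpa using hx (Pi.single 3 1)
      · simpa using hx (Pi.single 0 1)
    refine ⟨h, fun x hx => h x fun y => ?_⟩
    rw [QuadraticMap.polar_comm]
    exact hx y
  norm_mul x y := by
    simp [splitForm, splitMul, zornMul]
    ring
  e_mul x := by
    apply ext_fin_eight <;> simp [splitMul, zornMul]
  mul_e x := by
    apply ext_fin_eight <;> simp [splitMul, zornMul]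

end Split

end G2Spin

/-! ### Dimension of the even Clifford algebra and matrix units -/

namespace G2Spin

open CliffordAlgebra

section Intertwiner

/-- If `R` acts on `V` through an isomorphism onto `End V`, then every nonzero representation `M`
of `R` contains a copy of `V`. -/
theorem exists_injective_intertwiner {k R V M : Type*} [Field k] [Ring R] [Algebra k R]
    [AddCommGroup V] [Module k V] [FiniteDimensional k V] [AddCommGroup M] [Module k M]
    [Nontrivial M] (ρ : R →ₐ[k] Module.End k V) (hρ : Function.Bijective ρ)
    (σ : R →ₐ[k] Module.End k M) :
    ∃ T : V →ₗ[k] M, Function.Injective T ∧ ∀ r v, T (ρ r v) = σ r (T v) := by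
  let τ : Module.End k V →ₐ[k] Module.End k M :=
    σ.comp (AlgEquiv.ofBijective ρ hρ).symm.toAlgHom
  have hτ : ∀ r, τ (ρ r) = σ r := fun r =>
    congrArg σ ((AlgEquiv.ofBijective ρ hρ).symm_apply_apply r)
  let b := Module.finBasis k V
  -- The identity of `V` is the sum of the projections to the basis lines; one of them, say
  -- `ξ ⊗ b j`, acts on `M` as a nonzero operator, and `v ↦ τ (ξ ⊗ v) m` is an intertwiner.
  obtain ⟨m, hm⟩ := exists_ne (0 : M)
  have hsum : ∑ j, (b.coord j).smulRight (b j) = (1 : Module.End k V) := by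
    ext v
    simp [b.sum_repr]
  obtain ⟨j, hj⟩ : ∃ j, τ ((b.coord j).smulRight (b j)) m ≠ 0 := by
    by_contra! h
    apply hm
    have h1 := congrArg (fun x => τ x m) hsum
    simpa [map_sum, h] using h1.symm
  let T : V →ₗ[k] M := (τ.toLinearMap.flip m) ∘ₗ LinearMap.smulRightₗ (b.coord j)
  have hTap : ∀ v, T v = τ ((b.coord j).smulRight v) m := fun v => rfl
  have hT : ∀ (x : Module.End k V) v, T (x v) = τ x (T v) := by
    intro x v
    rw [hTap, hTap, ← Module.End.mul_apply, ← map_mul]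
    congr 2
    ext w
    simp
  refine ⟨T, ?_, fun r v => by rw [hT, hτ]⟩
  rw [← LinearMap.ker_eq_bot, LinearMap.ker_eq_bot']
  intro v hv
  by_contra hv0
  obtain ⟨ξ, hξ⟩ := not_forall.mp (mt (Module.forall_dual_apply_eq_zero_iff k v).mp hv0)
  have h := hT (ξ.smulRight (b j)) v
  rw [hv, map_zero, LinearMap.smulRight_apply, map_smul, smul_eq_zero] at h
  exact h.elim hξ hj

end Intertwiner

section Dimension

variable {k : Type*} [Field k] {V : Type*} [AddCommGroup V] [Module k V] [FiniteDimensional k V]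

theorem exists_linearEquiv_exteriorAlgebra (Q : QuadraticForm k V) :
    Nonempty (CliffordAlgebra Q ≃ₗ[k] ExteriorAlgebra k V) := by
  obtain ⟨B, hB⟩ := LinearMap.BilinMap.toQuadraticMap_surjective (0 - Q)
  exact ⟨changeFormEquiv hB⟩

theorem finiteDimensional_cliffordAlgebra (Q : QuadraticForm k V) :
    FiniteDimensional k (CliffordAlgebra Q) := by
  obtain ⟨φ⟩ := exists_linearEquiv_exteriorAlgebra Q
  have := Module.Finite.of_basis (Module.finBasis k V).ExteriorAlgebra
  exact Module.Finite.equiv φ.symm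

theorem finrank_cliffordAlgebra (Q : QuadraticForm k V) :
    Module.finrank k (CliffordAlgebra Q) = 2 ^ Module.finrank k V := by
  obtain ⟨φ⟩ := exists_linearEquiv_exteriorAlgebra Q
  rw [φ.finrank_eq, Module.finrank_eq_card_basis (Module.finBasis k V).ExteriorAlgebra]
  simp

/-- Multiplication by a vector on which the form does not vanish exchanges the even and the odd
part, so each of them has half the dimension of the Clifford algebra. -/
theorem two_mul_finrank_even (Q : QuadraticForm k V) (v : V) (hv : Q v ≠ 0) :
    2 * Module.finrank k (even Q) = 2 ^ Module.finrank k V := by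
  have := finiteDimensional_cliffordAlgebra Q
  rw [← finrank_cliffordAlgebra Q, ← Submodule.finrank_add_eq_of_isCompl (evenOdd_isCompl Q)]
  let u : CliffordAlgebra Q ≃ₗ[k] CliffordAlgebra Q := LinearEquiv.ofLinearMap
    (LinearMap.mulLeft k (ιUnit Q v hv)) (LinearMap.mulLeft k ↑(ιUnit Q v hv)⁻¹)
    (by ext; simp) (by ext; simp)
  have hu : ∀ x, u x = ι Q v * x := fun _ => rfl
  have h : (evenOdd Q 0).map u.toLinearMap = evenOdd Q 1 := by
    apply le_antisymm
    · rintro _ ⟨x, hx, rfl⟩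
      exact evenOdd_mul_le Q 1 0 (Submodule.mul_mem_mul (ι_mem_evenOdd_one Q v) hx)
    · intro x hx
      refine ⟨(Q v)⁻¹ • (ι Q v * x), Submodule.smul_mem _ _ ?_, ?_⟩
      · exact evenOdd_mul_le Q 1 1 (Submodule.mul_mem_mul (ι_mem_evenOdd_one Q v) hx)
      · change ι Q v * _ = _
        rw [mul_smul_comm, ← mul_assoc, ι_sq_scalar, Algebra.smul_def, ← mul_assoc, ← map_mul,
          inv_mul_cancel₀ hv, map_one, one_mul]
  have h' := u.finrank_map_eq (evenOdd Q 0)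
  rw [h] at h'
  rw [h', two_mul]
  rfl

end Dimension

section SplitRep

variable (k : Type*) [Field k]

/-- The left multiplications by pure split octonions generate all endomorphisms, already through
their products with an even number of factors: these contain all matrix units. -/
theorem eq_top_of_pure_mul_mem (A : Subalgebra k (Module.End k (Fin 8 → k)))
    (hA : ∀ x ∈ (splitOctonion k).pure, ∀ y ∈ (splitOctonion k).pure,
      splitMul k x * splitMul k y ∈ A) : A = ⊤ := by
  have hpure : ∀ x : Fin 8 → k, x 0 + x 7 = 0 → x ∈ (splitOctonion k).pure := by
    intro x hx
    change QuadraticMap.polar (splitForm k).toQuadraticMap ![1, 0, 0, 0, 0, 0, 0, 1] x = 0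
    rw [LinearMap.BilinMap.polar_toQuadraticMap]
    simpa [splitForm, add_comm] using hx
  -- With `U₁, U₂, U₃, V₁, V₂, V₃` the basis of the two off-diagonal vector spaces and `Z` the
  -- diagonal pure octonion, the operators below are the left multiplications.
  let U₁ := splitMul k (Pi.single 1 1)
  let U₂ := splitMul k (Pi.single 2 1)
  let U₃ := splitMul k (Pi.single 3 1)
  let V₁ := splitMul k (Pi.single 4 1)
  let V₂ := splitMul k (Pi.single 5 1)
  let V₃ := splitMul k (Pi.single 6 1)
  let Z := splitMul k ![1, 0, 0, 0, 0, 0, 0, -1]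
  have hU₁ : ∀ y, U₁ y = ![y 4, y 7, 0, 0, 0, -y 3, y 2, 0] := fun y => by
    apply ext_fin_eight <;> simp [U₁, splitMul, zornMul]
  have hU₂ : ∀ y, U₂ y = ![y 5, 0, y 7, 0, y 3, 0, -y 1, 0] := fun y => by
    apply ext_fin_eight <;> simp [U₂, splitMul, zornMul]
  have hU₃ : ∀ y, U₃ y = ![y 6, 0, 0, y 7, -y 2, y 1, 0, 0] := fun y => by
    apply ext_fin_eight <;> simp [U₃, splitMul, zornMul]
  have hV₁ : ∀ y, V₁ y = ![0, 0, y 6, -y 5, y 0, 0, 0, y 1] := fun y => by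
    apply ext_fin_eight <;> simp [V₁, splitMul, zornMul]
  have hV₂ : ∀ y, V₂ y = ![0, -y 6, 0, y 4, 0, y 0, 0, y 2] := fun y => by
    apply ext_fin_eight <;> simp [V₂, splitMul, zornMul]
  have hV₃ : ∀ y, V₃ y = ![0, y 5, -y 4, 0, 0, 0, y 0, y 3] := fun y => by
    apply ext_fin_eight <;> simp [V₃, splitMul, zornMul]
  have hZ : ∀ y, Z y = ![y 0, y 1, y 2, y 3, -y 4, -y 5, -y 6, -y 7] := fun y => by
    apply ext_fin_eight <;> simp [Z, splitMul, zornMul]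
  have h1 := hpure (Pi.single 1 1) (by simp)
  have h2 := hpure (Pi.single 2 1) (by simp)
  have h3 := hpure (Pi.single 3 1) (by simp)
  have h4 := hpure (Pi.single 4 1) (by simp)
  have h5 := hpure (Pi.single 5 1) (by simp)
  have h6 := hpure (Pi.single 6 1) (by simp)
  have hz := hpure ![1, 0, 0, 0, 0, 0, 0, -1] (by simp)
  -- The projection to the first coordinate.
  let p := (U₁ * V₁) * (U₂ * V₂) * (U₃ * V₃)
  have hp : p ∈ A := mul_mem (mul_mem (hA _ h1 _ h4) (hA _ h2 _ h5)) (hA _ h3 _ h6)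
  have hp' : ∀ x, p x = ![x 0, 0, 0, 0, 0, 0, 0, 0] := fun x => by
    simp [p, hU₁, hU₂, hU₃, hV₁, hV₂, hV₃]
  have hcol : ∀ j, ∃ a ∈ A, ∀ x : Fin 8 → k, a (p x) = x 0 • Pi.single j 1 := by
    have key : ∀ (j : Fin 8) (a : Module.End k (Fin 8 → k)), a ∈ A →
        (∀ x : Fin 8 → k, a ![x 0, 0, 0, 0, 0, 0, 0, 0] = x 0 • Pi.single j 1) →
        ∃ a ∈ A, ∀ x : Fin 8 → k, a (p x) = x 0 • Pi.single j 1 :=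
      fun j a ha h => ⟨a, ha, fun x => by rw [hp', h]⟩
    intro j
    fin_cases j
    · refine key _ 1 (one_mem A) fun x => ?_
      apply ext_fin_eight <;> simp
    · refine key _ (V₃ * V₂) (hA _ h6 _ h5) fun x => ?_
      apply ext_fin_eight <;> simp [hV₃, hV₂]
    · refine key _ (V₁ * V₃) (hA _ h4 _ h6) fun x => ?_
      apply ext_fin_eight <;> simp [hV₃, hV₁]
    · refine key _ (V₂ * V₁) (hA _ h5 _ h4) fun x => ?_
      apply ext_fin_eight <;> simp [hV₂, hV₁]
    · refine key _ (V₁ * Z) (hA _ h4 _ hz) fun x => ?_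
      apply ext_fin_eight <;> simp [hZ, hV₁]
    · refine key _ (V₂ * Z) (hA _ h5 _ hz) fun x => ?_
      apply ext_fin_eight <;> simp [hZ, hV₂]
    · refine key _ (V₃ * Z) (hA _ h6 _ hz) fun x => ?_
      apply ext_fin_eight <;> simp [hZ, hV₃]
    · refine key _ ((V₃ * Z) * (V₂ * V₁)) (mul_mem (hA _ h6 _ hz) (hA _ h5 _ h4)) fun x => ?_
      apply ext_fin_eight <;> simp [hZ, hV₁, hV₂, hV₃]
  have hrow : ∀ j, ∃ a ∈ A, ∀ x : Fin 8 → k, (a x) 0 = x j := by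
    intro j
    fin_cases j
    · exact ⟨1, one_mem A, fun x => rfl⟩
    · exact ⟨U₂ * U₃, hA _ h2 _ h3, fun x => by simp [hU₂, hU₃]⟩
    · exact ⟨U₃ * U₁, hA _ h3 _ h1, fun x => by simp [hU₁, hU₃]⟩
    · exact ⟨U₁ * U₂, hA _ h1 _ h2, fun x => by simp [hU₁, hU₂]⟩
    · exact ⟨Z * U₁, hA _ hz _ h1, fun x => by simp [hU₁, hZ]⟩
    · exact ⟨Z * U₂, hA _ hz _ h2, fun x => by simp [hU₂, hZ]⟩
    · exact ⟨Z * U₃, hA _ hz _ h3, fun x => by simp [hU₃, hZ]⟩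
    · exact ⟨(U₂ * U₃) * (Z * U₁), mul_mem (hA _ h2 _ h3) (hA _ hz _ h1),
        fun x => by simp [hU₁, hU₂, hU₃, hZ]⟩
  choose c hcA hc using hcol
  choose r hrA hr using hrow
  refine Algebra.eq_top_iff.mpr fun g => ?_
  have hg : g = ∑ i, ∑ j, g (Pi.single j 1) i • (c i * p * r j) := by
    refine LinearMap.ext fun x => ?_
    conv_lhs => rw [← (Pi.basisFun k (Fin 8)).sum_repr x]
    ext i
    simp [hc, hr, Finset.sum_apply, Pi.single_apply, mul_comm]
  rw [hg]
  exact sum_mem fun i _ => sum_mem fun j _ =>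
    A.smul_mem (mul_mem (mul_mem (hcA i) hp) (hrA j)) _

end SplitRep
end G2Spin

/-! ### Classification of nondefective forms in seven variables -/

namespace G2Spin

open QuadraticMap

section Classification

variable {k : Type*} [Field k] {V : Type*} [AddCommGroup V] [Module k V]

/-- A quadratic form is nondefective if it does not vanish at any nonzero vector of the kernel of
its polar form. -/
def Nondefective (Q : QuadraticForm k V) : Prop :=
  ∀ x, Q x = 0 → (∀ y, polar Q x y = 0) → x = 0

theorem IsRegular.nondefective {Q : QuadraticForm k V} (hQ : IsRegular Q) : Nondefective Q := by
  intro x hx hxy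
  obtain hQ | ⟨-, -, h1, p, hp, hQp⟩ := hQ
  · exact hQ.1 x hxy
  · have hxker : x ∈ LinearMap.ker Q.polarBilin := LinearMap.ext hxy
    have hp0 : (⟨p, hp⟩ : LinearMap.ker Q.polarBilin) ≠ 0 := by
      rintro h
      apply hQp
      rw [show p = 0 from congrArg Subtype.val h, QuadraticMap.map_zero]
    obtain ⟨c, hc⟩ := exists_smul_eq_of_finrank_eq_one h1 hp0 ⟨x, hxker⟩
    have hc' : c • p = x := congrArg Subtype.val hc
    rw [← hc', QuadraticMap.map_smul, smul_eq_mul, mul_eq_zero, or_iff_left hQp,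
      mul_self_eq_zero] at hx
    rw [← hc', hx, zero_smul]

variable [IsAlgClosed k]

theorem exists_isotropic (Q : QuadraticForm k V) (hV : 2 ≤ Module.finrank k V) :
    ∃ e, e ≠ 0 ∧ Q e = 0 := by
  have : Nontrivial V := Module.nontrivial_of_finrank_pos (R := k) (by omega)
  obtain ⟨x, hx⟩ := exists_ne (0 : V)
  obtain ⟨y, hy⟩ : ∃ y, y ∉ Submodule.span k {x} := by
    by_contra! h
    have h1 := finrank_span_singleton (K := k) hx
    rw [(Submodule.eq_top_iff'.mpr h), finrank_top] at h1
    omega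
  by_cases hQy : Q y = 0
  · exact ⟨y, fun h => hy (h ▸ zero_mem _), hQy⟩
  · open Polynomial in
    obtain ⟨t, ht⟩ := IsAlgClosed.exists_root (C (Q y) * X ^ 2 + C (polar Q x y) * X + C (Q x))
      (by rw [degree_quadratic hQy]; norm_num)
    refine ⟨x + t • y, fun h => ?_, ?_⟩
    · have ht0 : t ≠ 0 := by
        rintro rfl
        simp [hx] at h
      refine hy (Submodule.mem_span_singleton.mpr ⟨-t⁻¹, ?_⟩)
      rw [eq_neg_of_add_eq_zero_left h, smul_neg, neg_smul, neg_neg, smul_smul,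
        inv_mul_cancel₀ ht0, one_smul]
    · simp only [Polynomial.IsRoot, Polynomial.eval_add, Polynomial.eval_mul,
        Polynomial.eval_C, Polynomial.eval_pow, Polynomial.eval_X] at ht
      rw [QuadraticMap.map_add Q, QuadraticMap.map_smul, polar_smul_right, smul_eq_mul,
        smul_eq_mul]
      linear_combination ht

/-- A nondefective form in at least two variables splits off a hyperbolic plane. -/
theorem Nondefective.exists_hyperbolic_pair [FiniteDimensional k V] {Q : QuadraticForm k V}
    (hQ : Nondefective Q) {n : ℕ} (hV : Module.finrank k V = n + 2) :
    ∃ e f : V, Q e = 0 ∧ Q f = 0 ∧ polar Q e f = 1 ∧ ∃ W : Submodule k V,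
      Module.finrank k W = n ∧ (∀ x ∈ W, polar Q e x = 0 ∧ polar Q f x = 0) ∧
      Nondefective (Q.comp W.subtype) := by
  obtain ⟨e, he0, he⟩ := exists_isotropic Q (by omega)
  obtain ⟨f₀, hf₀⟩ : ∃ f₀, polar Q e f₀ ≠ 0 := by
    by_contra! h
    exact he0 (hQ e he h)
  obtain ⟨f₁, hf₁⟩ : ∃ f₁, polar Q e f₁ = 1 :=
    ⟨(polar Q e f₀)⁻¹ • f₀, by rw [polar_smul_right, smul_eq_mul, inv_mul_cancel₀ hf₀]⟩
  obtain ⟨f, hf, hef⟩ : ∃ f, Q f = 0 ∧ polar Q e f = 1 := by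
    refine ⟨f₁ + (-Q f₁) • e, ?_, ?_⟩
    · rw [QuadraticMap.map_add Q, QuadraticMap.map_smul, polar_smul_right, he,
        polar_comm Q f₁ e, hf₁]
      simp
    · rw [polar_add_right, polar_smul_right, polar_self, he, hf₁]
      simp
  have hee : polar Q e e = 0 := by rw [polar_self, he, smul_zero]
  have hff : polar Q f f = 0 := by rw [polar_self, hf, smul_zero]
  have hfe : polar Q f e = 1 := by rw [polar_comm, hef]
  let L : V →ₗ[k] k × k := (Q.polarBilin e).prod (Q.polarBilin f)
  have hL : ∀ x, L x = (polar Q e x, polar Q f x) := fun _ => rfl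
  have hW : ∀ x ∈ LinearMap.ker L, polar Q e x = 0 ∧ polar Q f x = 0 := fun x hx => by
    simpa [hL] using hx
  refine ⟨e, f, he, hf, hef, LinearMap.ker L, ?_, hW, ?_⟩
  · have hsurj : LinearMap.range L = ⊤ := LinearMap.range_eq_top.mpr fun y =>
      ⟨y.1 • f + y.2 • e, by simp [hL, hee, hff, hef, hfe, polar_add_right, polar_smul_right]⟩
    have h := L.finrank_range_add_finrank_ker
    rw [hsurj, finrank_top, hV] at h
    simp at h
    omega
  · rintro ⟨x, hx⟩ hQx hxW
    refine Subtype.ext (hQ x hQx fun y => ?_)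
    let w := y - (polar Q f y • e + polar Q e y • f)
    have hw : w ∈ LinearMap.ker L := by
      simp [w, hL, hee, hff, hef, hfe, polar_sub_right, polar_add_right, polar_smul_right]
    have hxw : polar Q x w = 0 := hxW ⟨w, hw⟩
    have hy : y = w + (polar Q f y • e + polar Q e y • f) := by simp [w]
    rw [hy, polar_add_right, polar_add_right, polar_smul_right, polar_smul_right, hxw,
      polar_comm Q x e, polar_comm Q x f, (hW x hx).1, (hW x hx).2]
    simp

end Classification

section SplitPure

variable {k : Type*} [Field k]

theorem mem_pure_splitOctonion {x : Fin 8 → k} :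
    x ∈ (splitOctonion k).pure ↔ x 0 + x 7 = 0 := by
  change polar (splitForm k).toQuadraticMap ![1, 0, 0, 0, 0, 0, 0, 1] x = 0 ↔ _
  rw [LinearMap.BilinMap.polar_toQuadraticMap]
  simp [splitForm, add_comm]

theorem OctonionAlgebra.finrank_pure {C : Type*} [AddCommGroup C] [Module k C]
    (O : OctonionAlgebra k C) : Module.finrank k O.pure = 7 := by
  have := O.finiteDimensional
  have hne : O.norm.polarBilin O.e ≠ 0 := fun h =>
    O.e_ne_zero (O.nondegenerate.1 _ fun y => by rw [h, LinearMap.zero_apply])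
  have h := Module.Dual.finrank_ker_add_one_of_ne_zero hne
  rw [O.finrank_eq] at h
  exact Nat.succ_injective h

theorem nondefective_pure_splitOctonion :
    Nondefective ((splitOctonion k).norm.comp (splitOctonion k).pure.subtype) := by
  rintro ⟨x, hx⟩ hQx h
  have hpolar : ∀ y ∈ (splitOctonion k).pure, polar (splitForm k).toQuadraticMap x y = 0 :=
    fun y hy => h ⟨y, hy⟩
  simp only [LinearMap.BilinMap.polar_toQuadraticMap, splitForm, LinearMap.mk₂_apply,
    mem_pure_splitOctonion] at hpolar hx
  have h4 : x 4 = 0 := by simpa using hpolar (Pi.single 1 1) (by simp)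
  have h5 : x 5 = 0 := by simpa using hpolar (Pi.single 2 1) (by simp)
  have h6 : x 6 = 0 := by simpa using hpolar (Pi.single 3 1) (by simp)
  have h1 : x 1 = 0 := by simpa using hpolar (Pi.single 4 1) (by simp)
  have h2 : x 2 = 0 := by simpa using hpolar (Pi.single 5 1) (by simp)
  have h3 : x 3 = 0 := by simpa using hpolar (Pi.single 6 1) (by simp)
  have h7 : x 7 = -x 0 := by linear_combination hx
  have hN : x 0 * x 7 - x 1 * x 4 - x 2 * x 5 - x 3 * x 6 = 0 := hQx
  have h0 : x 0 = 0 := by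
    rw [h7, h1, h2, h3] at hN
    simpa using hN
  refine Subtype.ext (ext_fin_eight ?_ ?_ ?_ ?_ ?_ ?_ ?_ ?_) <;> simp [*]

/-- Over an algebraically closed field there is only one nondefective quadratic form in seven
variables up to isometry: the norm form of the pure split octonions. -/
theorem Nondefective.nonempty_isometryEquiv_pure_splitOctonion [IsAlgClosed k] {V : Type*}
    [AddCommGroup V] [Module k V] {Q : QuadraticForm k V} (hQ : Nondefective Q)
    (hV : Module.finrank k V = 7) :
    Nonempty (Q.IsometryEquiv ((splitOctonion k).norm.comp (splitOctonion k).pure.subtype)) := by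
  have : FiniteDimensional k V := Module.finite_of_finrank_pos (by omega)
  obtain ⟨e₁, f₁, he₁, hf₁, hef₁, W₁, hW₁, hort₁, hQ₁⟩ := hQ.exists_hyperbolic_pair (n := 5) hV
  obtain ⟨e₂, f₂, he₂, hf₂, hef₂, W₂, hW₂, hort₂, hQ₂⟩ := hQ₁.exists_hyperbolic_pair (n := 3) hW₁
  obtain ⟨e₃, f₃, he₃, hf₃, hef₃, W₃, hW₃, hort₃, hQ₃⟩ := hQ₂.exists_hyperbolic_pair (n := 1) hW₂
  have : Nontrivial W₃ := Module.nontrivial_of_finrank_pos (R := k) (by omega)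
  obtain ⟨z₀, hz₀⟩ := exists_ne (0 : W₃)
  have hQz₀ : Q z₀ ≠ 0 := by
    intro h
    refine hz₀ (hQ₃ z₀ h fun y => ?_)
    obtain ⟨c, rfl⟩ := exists_smul_eq_of_finrank_eq_one hW₃ hz₀ y
    rw [polar_smul_right, polar_self]
    simp [h]
  obtain ⟨c, hc⟩ := IsAlgClosed.exists_pow_nat_eq (-(Q z₀)⁻¹) (n := 2) (by norm_num)
  obtain ⟨z, hz⟩ : ∃ z : W₃, Q z = -1 := ⟨c • z₀, by
    simp only [Submodule.coe_smul, QuadraticMap.map_smul, smul_eq_mul]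
    rw [← pow_two, hc, neg_mul, inv_mul_cancel₀ hQz₀]⟩
  -- The isometry sends the diagonal octonion to `z` and the two off-diagonal bases to the `e`s and
  -- to the negatives of the `f`s, as the norm of a pure octonion is `-x₀² - x₁x₄ - x₂x₅ - x₃x₆`.
  let E₂ : V := e₂
  let F₂ : V := f₂
  let E₃ : V := (e₃ : W₁)
  let F₃ : V := (f₃ : W₁)
  let Z : V := ((z : W₂) : W₁)
  have a₁ := fun x : W₁ => (hort₁ x x.2).1
  have b₁ := fun x : W₁ => (hort₁ x x.2).2
  have a₂ : ∀ x : W₂, polar Q E₂ (x : W₁) = 0 := fun x => (hort₂ x x.2).1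
  have b₂ : ∀ x : W₂, polar Q F₂ (x : W₁) = 0 := fun x => (hort₂ x x.2).2
  have a₃ : polar Q E₃ Z = 0 := (hort₃ z z.2).1
  have b₃ : polar Q F₃ Z = 0 := (hort₃ z z.2).2
  have hE₂ : Q E₂ = 0 := he₂
  have hF₂ : Q F₂ = 0 := hf₂
  have hE₃ : Q E₃ = 0 := he₃
  have hF₃ : Q F₃ = 0 := hf₃
  have hEF₂ : polar Q E₂ F₂ = 1 := hef₂
  have hEF₃ : polar Q E₃ F₃ = 1 := hef₃
  let π (j : Fin 8) : (splitOctonion k).pure →ₗ[k] k :=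
    LinearMap.proj j ∘ₗ (splitOctonion k).pure.subtype
  let T : (splitOctonion k).pure →ₗ[k] V :=
    (π 1).smulRight e₁ - (π 4).smulRight f₁ + (π 2).smulRight E₂ - (π 5).smulRight F₂ +
      (π 3).smulRight E₃ - (π 6).smulRight F₃ + (π 0).smulRight Z
  have hTapp : ∀ x, T x = x.1 1 • e₁ + (-x.1 4) • f₁ + x.1 2 • E₂ + (-x.1 5) • F₂ +
      x.1 3 • E₃ + (-x.1 6) • F₃ + x.1 0 • Z := fun x => by
    simp only [neg_smul, ← sub_eq_add_neg]
    rfl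
  have hT : ∀ x, Q (T x) = (splitOctonion k).norm x.1 := by
    intro x
    have hx : x.1 7 = -x.1 0 := by linear_combination mem_pure_splitOctonion.mp x.2
    have hN : (splitOctonion k).norm x.1 =
      x.1 0 * x.1 7 - x.1 1 * x.1 4 - x.1 2 * x.1 5 - x.1 3 * x.1 6 := rfl
    rw [hTapp, hN, hx]
    simp only [QuadraticMap.map_add Q, QuadraticMap.map_smul, polar_add_left, polar_smul_left,
      polar_smul_right, he₁, hf₁, hef₁, hE₂, hF₂, hE₃, hF₃, hEF₂, hEF₃, hz, a₁, b₁, a₂, b₂, a₃,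
      b₃, E₂, F₂, E₃, F₃, Z, smul_eq_mul]
    ring
  have hTinj : Function.Injective T := by
    rw [← LinearMap.ker_eq_bot, LinearMap.ker_eq_bot']
    intro x hx
    refine nondefective_pure_splitOctonion x ?_ fun y => ?_
    · change (splitOctonion k).norm x.1 = 0
      rw [← hT, hx, QuadraticMap.map_zero]
    · change (splitOctonion k).norm (x + y : (splitOctonion k).pure).1 -
        (splitOctonion k).norm x.1 - (splitOctonion k).norm y.1 = 0
      rw [← hT, ← hT, ← hT, map_add, hx, QuadraticMap.map_zero, zero_add]
      ring
  let T' := LinearEquiv.ofInjectiveOfFinrankEq T hTinj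
    (by rw [OctonionAlgebra.finrank_pure, hV])
  exact ⟨QuadraticMap.IsometryEquiv.symm { T' with map_app' := hT }⟩

end SplitPure
end G2Spin

/-! ### The spin representation on octonion algebras -/

namespace G2Spin

open CliffordAlgebra

section Scalar

variable {k V : Type*} [Field k] [AddCommGroup V] [Module k V]

theorem exists_eq_smul_one_of_forall_commute {X : Module.End k V} (h : ∀ Y, Commute X Y) :
    ∃ c : k, X = c • 1 := by
  have hX : X ∈ Subalgebra.center k (Module.End k V) :=
    Subalgebra.mem_center_iff.mpr fun Y => (h Y).symm
  rw [Algebra.IsCentral.center_eq_bot] at hX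
  obtain ⟨c, hc⟩ := Algebra.mem_bot.mp hX
  exact ⟨c, by rw [← hc, Algebra.algebraMap_eq_smul_one]⟩

/-- Only scalars commute with the products of two left multiplications by pure split octonions. -/
theorem exists_eq_smul_one_of_commute_pure {X : Module.End k (Fin 8 → k)}
    (h : ∀ x ∈ (splitOctonion k).pure, ∀ y ∈ (splitOctonion k).pure,
      Commute X (splitMul k x * splitMul k y)) : ∃ c : k, X = c • 1 := by
  have htop := eq_top_of_pure_mul_mem k (Subalgebra.centralizer k {X}) fun x hx y hy =>
    Subalgebra.mem_centralizer_iff k |>.mpr (by rintro _ rfl; exact h x hx y hy)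
  refine exists_eq_smul_one_of_forall_commute fun Y => ?_
  have hY : Y ∈ Subalgebra.centralizer k {X} := htop ▸ Algebra.mem_top
  exact Subalgebra.mem_centralizer_iff k |>.mp hY X rfl

end Scalar

section EvenRep

variable {k : Type*} [Field k] {P : Type*} [AddCommGroup P] [Module k P]
  {Q : QuadraticForm k P} {i : k} (hi : i ^ 2 = -1)

theorem finrank_even_eq (f : Q.IsometryEquiv
      ((splitOctonion k).norm.comp (splitOctonion k).pure.subtype)) :
    Module.finrank k (even Q) = 64 := by
  have h7 : Module.finrank k P = 7 := by
    rw [f.toLinearEquiv.finrank_eq, OctonionAlgebra.finrank_pure]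
  have : FiniteDimensional k P := Module.finite_of_finrank_pos (by omega)
  let z : (splitOctonion k).pure :=
    ⟨![1, 0, 0, 0, 0, 0, 0, -1], mem_pure_splitOctonion.mpr (by simp)⟩
  have hz : Q (f.symm z) = -1 := by
    rw [f.symm.map_app]
    change splitForm k ![1, 0, 0, 0, 0, 0, 0, -1] ![1, 0, 0, 0, 0, 0, 0, -1] = -1
    simp [splitForm]
  have h := two_mul_finrank_even Q (f.symm z) (by rw [hz]; simp)
  rw [h7] at h
  omega

/-- The even Clifford algebra of the pure split octonions is the full endomorphism algebra of the
split octonions. -/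
theorem bijective_even_splitOctonion (f : Q.IsometryEquiv
      ((splitOctonion k).norm.comp (splitOctonion k).pure.subtype)) :
    Function.Bijective
      (((splitOctonion k).cliffordRep f.toIsometry hi).comp (even Q).val) := by
  let ρ := ((splitOctonion k).cliffordRep f.toIsometry hi).comp (even Q).val
  have h64 := finrank_even_eq f
  have : FiniteDimensional k (even Q) := Module.finite_of_finrank_pos (by omega)
  have hsurj : Function.Surjective ρ := by
    rw [← AlgHom.range_eq_top]
    refine eq_top_of_pure_mul_mem k _ fun x hx y hy => ?_
    refine ⟨-⟨ι Q (f.symm ⟨x, hx⟩) * ι Q (f.symm ⟨y, hy⟩), ι_mul_ι_mem_evenOdd_zero Q _ _⟩, ?_⟩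
    have key : ∀ x (hx : x ∈ (splitOctonion k).pure) w,
        (splitOctonion k).cliffordRep f.toIsometry hi (ι Q (f.symm ⟨x, hx⟩)) w =
          i • splitMul k x w := fun x hx w => by
      rw [OctonionAlgebra.cliffordRep_ι]
      change i • splitMul k (f (f.symm ⟨x, hx⟩) : (splitOctonion k).pure) w = _
      rw [f.apply_symm_apply]
    refine LinearMap.ext fun w => ?_
    change (ρ (-_)) w = _
    simp [ρ, key, smul_smul, ← pow_two, hi]
  refine ⟨?_, hsurj⟩
  have hfin : Module.finrank k (even Q) = Module.finrank k (Module.End k (Fin 8 → k)) := by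
    rw [h64, Module.finrank_linearMap]
    simp
  exact (LinearMap.injective_iff_surjective_of_finrank_eq_finrank (f := ρ.toLinearMap) hfin).mpr
    hsurj

/-- The even Clifford algebra of the pure octonions is the full endomorphism algebra of the
octonion algebra. -/
theorem bijective_even_octonion [IsAlgClosed k] (hQ : Nondefective Q)
    (hP : Module.finrank k P = 7) {C : Type*} [AddCommGroup C] [Module k C]
    (O : OctonionAlgebra k C) (f : Q →qᵢ O.norm.comp O.pure.subtype) :
    Function.Bijective ((O.cliffordRep f hi).comp (even Q).val) := by
  obtain ⟨f₀⟩ := hQ.nonempty_isometryEquiv_pure_splitOctonion hP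
  have h64 := finrank_even_eq f₀
  have : FiniteDimensional k (even Q) := Module.finite_of_finrank_pos (by omega)
  have := O.finiteDimensional
  have := O.nontrivial
  have h₀ := bijective_even_splitOctonion hi f₀
  let σ := (O.cliffordRep f hi).comp (even Q).val
  obtain ⟨T, hT, hTσ⟩ := exists_injective_intertwiner _ h₀ σ
  have hTsurj : Function.Surjective T :=
    (LinearMap.injective_iff_surjective_of_finrank_eq_finrank
      (by rw [O.finrank_eq]; simp)).mp hT
  have hinj : Function.Injective σ := by
    rw [injective_iff_map_eq_zero]
    intro r hr
    refine (injective_iff_map_eq_zero _).mp h₀.1 r (LinearMap.ext fun v => hT ?_)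
    rw [hTσ, hr]
    simp
  refine ⟨hinj, ?_⟩
  have hfin : Module.finrank k (even Q) = Module.finrank k (Module.End k C) := by
    rw [h64, Module.finrank_linearMap, O.finrank_eq]
  exact (LinearMap.injective_iff_surjective_of_finrank_eq_finrank (f := σ.toLinearMap) hfin).mp
    hinj

end EvenRep

/-! ### Surjectivity of the spin group onto `SO` -/

section Lift

variable {k : Type*} [Field k] {P : Type*} [AddCommGroup P] [Module k P]
  {Q : QuadraticForm k P}

theorem map_mem_even (g : Q →qᵢ Q) {x : CliffordAlgebra Q} (hx : x ∈ even Q) :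
    CliffordAlgebra.map g x ∈ even Q := by
  induction x, hx using even_induction with
  | algebraMap r => rw [AlgHom.commutes]; exact algebraMap_mem _ r
  | add x y _ _ hx hy => rw [map_add]; exact add_mem hx hy
  | ι_mul_ι_mul m₁ m₂ x _ hx =>
    rw [map_mul, map_mul, map_apply_ι, map_apply_ι]
    exact mul_mem (ι_mul_ι_mem_evenOdd_zero Q _ _) hx

theorem proj_mul (x : Spin Q) (v : P) :
    ι Q (proj Q x v) * ((x : (CliffordAlgebra Q)ˣ) : CliffordAlgebra Q) =
      (x : (CliffordAlgebra Q)ˣ) * ι Q v := by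
  rw [ι_proj, mul_assoc, Units.inv_mul, mul_one]

variable {S : Type*} [AddCommGroup S] [Module k S]
  (ρ : CliffordAlgebra Q →ₐ[k] Module.End k S)

/-- If the even Clifford algebra is an endomorphism algebra, its center consists of scalars. -/
theorem exists_algebraMap_eq_of_commute_even
    (hρ : Function.Bijective (ρ.comp (even Q).val))
    {t : CliffordAlgebra Q} (ht : t ∈ even Q)
    (h : ∀ r ∈ even Q, r * t = t * r) : ∃ c : k, t = algebraMap k _ c := by
  obtain ⟨c, hc⟩ := exists_eq_smul_one_of_forall_commute (X := ρ t) fun Y => by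
    obtain ⟨r, rfl⟩ := hρ.2 Y
    change ρ t * ρ r = ρ r * ρ t
    rw [← map_mul, ← map_mul, h r r.2]
  refine ⟨c, congrArg Subtype.val (hρ.1 (a₁ := ⟨t, ht⟩) (a₂ := algebraMap k _ c) ?_)⟩
  rw [AlgHom.commutes, Algebra.algebraMap_eq_smul_one]
  exact hc

/-- Isometries act on the even Clifford algebra by inner automorphisms (Skolem–Noether). -/
theorem exists_even_unit_conj_even [FiniteDimensional k S] [Nontrivial S]
    (hρ : Function.Bijective (ρ.comp (even Q).val)) (g : Q →qᵢ Q) :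
    ∃ u : (CliffordAlgebra Q)ˣ, (u : CliffordAlgebra Q) ∈ even Q ∧
      (↑u⁻¹ : CliffordAlgebra Q) ∈ even Q ∧
      ∀ r ∈ even Q, CliffordAlgebra.map g r * u = u * r := by
  obtain ⟨T, hT, hTσ⟩ := exists_injective_intertwiner _ hρ
    ((ρ.comp (CliffordAlgebra.map g)).comp (even Q).val)
  have hunit : IsUnit T := (LinearMap.isUnit_iff_ker_eq_bot T).mpr (LinearMap.ker_eq_bot.mpr hT)
  obtain ⟨T, rfl⟩ := hunit
  let e := AlgEquiv.ofBijective _ hρ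
  let u₀ : (even Q)ˣ := Units.map (e.symm : Module.End k S →* even Q) T
  have hu₀ : ρ ((u₀ : even Q) : CliffordAlgebra Q) = T := e.apply_symm_apply _
  refine ⟨Units.map ((even Q).val : even Q →* CliffordAlgebra Q) u₀, (u₀ : even Q).2,
    ((u₀⁻¹ : (even Q)ˣ) : even Q).2, fun r hr => ?_⟩
  have h : (⟨CliffordAlgebra.map g r, map_mem_even g hr⟩ : even Q) * u₀ = u₀ * ⟨r, hr⟩ := by
    apply hρ.1
    refine LinearMap.ext fun v => ?_
    have := hTσ ⟨r, hr⟩ v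
    simp only [map_mul, Module.End.mul_apply]
    change ρ (CliffordAlgebra.map g r) (ρ ((u₀ : even Q) : CliffordAlgebra Q) v) =
      ρ ((u₀ : even Q) : CliffordAlgebra Q) (ρ r v)
    rw [hu₀]
    exact this.symm
  exact congrArg Subtype.val h

/-- If a homomorphism `G` agrees with conjugation by `u` at `r` and at `Y r Y⁻¹`, then `r` commutes
with the element `Y⁻¹ u⁻¹ G(Y) u` that measures the failure of this at `Y`. -/
theorem commute_inv_mul_map_mul {A : Type*} [Ring A] [Algebra k A] (G : A →ₐ[k] A) (u Y : Aˣ)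
    {r : A} (hr : G r * u = u * r) (hr' : G (Y * r * ↑Y⁻¹) * u = u * (Y * r * ↑Y⁻¹)) :
    r * (↑Y⁻¹ * ↑u⁻¹ * G Y * u) = ↑Y⁻¹ * ↑u⁻¹ * G Y * u * r := by
  have h2 : r * ↑Y⁻¹ = ↑Y⁻¹ * (Y * r * ↑Y⁻¹) := by simp [mul_assoc]
  have h3 : (Y * r * ↑Y⁻¹) * ↑u⁻¹ = ↑u⁻¹ * G (Y * r * ↑Y⁻¹) := by
    rw [Units.mul_inv_eq_iff_eq_mul, mul_assoc (↑u⁻¹ : A), hr', Units.inv_mul_cancel_left]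
  calc r * (↑Y⁻¹ * ↑u⁻¹ * G Y * u)
      = ↑Y⁻¹ * ((Y * r * ↑Y⁻¹) * ↑u⁻¹) * G Y * u := by
        rw [← mul_assoc, ← mul_assoc, ← mul_assoc, h2]
        simp only [mul_assoc]
    _ = ↑Y⁻¹ * ↑u⁻¹ * (G (Y * r * ↑Y⁻¹) * G Y) * u := by
        rw [h3]
        simp only [mul_assoc]
    _ = ↑Y⁻¹ * ↑u⁻¹ * G Y * (G r * u) := by
        rw [← map_mul, Units.inv_mul_cancel_right, map_mul]
        simp only [mul_assoc]
    _ = ↑Y⁻¹ * ↑u⁻¹ * G Y * u * r := by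
        rw [hr]
        simp only [mul_assoc]

theorem inv_ιUnit_mem_odd (y : P) (hy : Q y ≠ 0) :
    (↑(ιUnit Q y hy)⁻¹ : CliffordAlgebra Q) ∈ evenOdd Q 1 :=
  Submodule.smul_mem _ _ (ι_mem_evenOdd_one Q y)

theorem mul_mem_evenOdd {a b : ZMod 2} {x z : CliffordAlgebra Q} (hx : x ∈ evenOdd Q a)
    (hz : z ∈ evenOdd Q b) : x * z ∈ evenOdd Q (a + b) :=
  evenOdd_mul_le Q _ _ (Submodule.mul_mem_mul hx hz)

theorem conj_mem_even (y : P) (hy : Q y ≠ 0) {r : CliffordAlgebra Q} (hr : r ∈ even Q) :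
    (ιUnit Q y hy : CliffordAlgebra Q) * r * ↑(ιUnit Q y hy)⁻¹ ∈ even Q :=
  mul_mem_evenOdd (a := 1) (b := 1) (mul_mem_evenOdd (a := 1) (b := 0) (ι_mem_evenOdd_one Q y) hr)
    (inv_ιUnit_mem_odd y hy)

theorem inv_mul_map_mul_mem_even (g : Q →qᵢ Q) (y : P) (hy : Q y ≠ 0)
    (u : (CliffordAlgebra Q)ˣ) (hu : (u : CliffordAlgebra Q) ∈ even Q)
    (hu' : (↑u⁻¹ : CliffordAlgebra Q) ∈ even Q) :
    ↑(ιUnit Q y hy)⁻¹ * ↑u⁻¹ * CliffordAlgebra.map g (ιUnit Q y hy) * ↑u ∈ even Q := by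
  have h : CliffordAlgebra.map g (ιUnit Q y hy) = ι Q (g y) := map_apply_ι g y
  rw [h]
  have h1 : ↑(ιUnit Q y hy)⁻¹ * ↑u⁻¹ * ι Q (g y) ∈ evenOdd Q (1 + 0 + 1) :=
    mul_mem_evenOdd (mul_mem_evenOdd (inv_ιUnit_mem_odd y hy) hu') (ι_mem_evenOdd_one Q _)
  rw [show (1 + 0 + 1 : ZMod 2) = 0 by decide] at h1
  exact mul_mem (S := Subalgebra k (CliffordAlgebra Q)) (s := even Q) h1 hu

/-- The inner automorphism of the even Clifford algebra induced by an isometry `g` acts on vectors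
as `g` up to a sign. -/
theorem exists_even_unit_conj_sign [FiniteDimensional k S] [Nontrivial S]
    (hρ : Function.Bijective (ρ.comp (even Q).val)) (g : Q →qᵢ Q) (y : P) (hy : Q y ≠ 0) :
    ∃ (u : (CliffordAlgebra Q)ˣ) (c : k), (u : CliffordAlgebra Q) ∈ even Q ∧
      (↑u⁻¹ : CliffordAlgebra Q) ∈ even Q ∧ c ^ 2 = 1 ∧
      ∀ v, c • ι Q (g v) * u = u * ι Q v := by
  obtain ⟨u, hu, hu', hug⟩ := exists_even_unit_conj_even ρ hρ g
  -- Both `g y` and `u y u⁻¹` induce the same automorphism of the even Clifford algebra, so they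
  -- differ by a central element of it.
  obtain ⟨c, hc⟩ := exists_algebraMap_eq_of_commute_even ρ hρ
    (inv_mul_map_mul_mem_even g y hy u hu hu')
    (fun r hr => commute_inv_mul_map_mul (CliffordAlgebra.map g) u (ιUnit Q y hy) (hug r hr)
      (hug _ (conj_mem_even y hy hr)))
  obtain ⟨Y, hY⟩ : ∃ Y : (CliffordAlgebra Q)ˣ, Y = ιUnit Q y hy := ⟨_, rfl⟩
  have hYv : ι Q y = Y := by rw [hY]; rfl
  rw [← hY] at hc
  have hy' : ι Q (g y) * u = c • (u * ι Q y) := by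
    have hGY : CliffordAlgebra.map g Y = ι Q (g y) := by rw [← hYv, map_apply_ι]
    rw [hGY, mul_assoc, mul_assoc, Units.inv_mul_eq_iff_eq_mul, Units.inv_mul_eq_iff_eq_mul] at hc
    rw [hc, ← Algebra.commutes c, Algebra.smul_def, Algebra.left_comm, hYv]
  have hv : ∀ v, c • ι Q (g v) * u = u * ι Q v := by
    intro v
    have h := hug _ (ι_mul_ι_mem_evenOdd_zero Q v y)
    rw [map_mul, map_apply_ι, map_apply_ι, mul_assoc, hy', mul_smul_comm, ← mul_assoc,
      ← mul_assoc, ← smul_mul_assoc] at h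
    rw [hYv] at h
    rw [smul_mul_assoc]
    exact (Units.mul_left_inj Y).mp h
  refine ⟨u, c, hu, hu', ?_, hv⟩
  have h := hv y
  rw [smul_mul_assoc, hy', smul_smul] at h
  have : Nontrivial (CliffordAlgebra Q) := ⟨0, ι Q y, fun h0 => hy (by
    have := ι_injective Q (h0.symm.trans (map_zero (ι Q)).symm)
    rw [show y = 0 from this, QuadraticMap.map_zero])⟩
  have h0 : (c ^ 2 - 1) • ((u * Y : (CliffordAlgebra Q)ˣ) : CliffordAlgebra Q) = 0 := by
    rw [sub_smul, one_smul, pow_two, Units.val_mul, ← hYv, sub_eq_zero]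
    exact h
  exact sub_eq_zero.mp ((smul_eq_zero.mp h0).resolve_right (Units.ne_zero _))

/-- In odd dimension the spin group maps onto `SO`. -/
theorem exists_spin_proj_eq [IsAlgClosed k] [FiniteDimensional k S] [Nontrivial S]
    [FiniteDimensional k P] (hP : Odd (Module.finrank k P))
    (hρ : Function.Bijective (ρ.comp (even Q).val)) (y : P) (hy : Q y ≠ 0)
    (g : P ≃ₗ[k] P) (hg : g ∈ SO Q) : ∃ x : Spin Q, proj Q x = g := by
  -- Conjugation by `u` is `c • g` on vectors, and the determinant decides between `c = 1` and
  -- `c = -1` unless these coincide.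
  let g₁ : Q →qᵢ Q := { (g : P →ₗ[k] P) with map_app' := hg.1 }
  obtain ⟨u, c, hu, hu', hc, hv⟩ := exists_even_unit_conj_sign ρ hρ g₁ y hy
  have hc1 : c = 1 := by
    by_cases h2 : (2 : k) = 0
    · have h : (c - 1) ^ 2 = 0 := by linear_combination hc + (1 - c) * h2
      exact sub_eq_zero.mp (pow_eq_zero_iff (by norm_num) |>.mp h)
    · let g₂ : Q →qᵢ Q :=
        { c • (g : P →ₗ[k] P) with
          map_app' := fun v => by
            change Q (c • g v) = Q v
            rw [QuadraticMap.map_smul, hg.1, ← pow_two, hc, one_smul] }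
      have h := det_eq_one_of_conj hP h2 Q y hy g₂ u fun v => by
        change ι Q (c • g v) * _ = _
        rw [map_smul]
        exact hv v
      change LinearMap.det (c • (g : P →ₗ[k] P)) = 1 at h
      rw [LinearMap.det_smul, ← LinearEquiv.coe_det, hg.2, Units.val_one, mul_one] at h
      obtain ⟨m, hm⟩ := hP
      rwa [hm, pow_succ, pow_mul, hc, one_pow, one_mul] at h
  subst hc1
  have hv : ∀ v, ι Q (g v) * u = u * ι Q v := fun v => by
    have := hv v
    rwa [one_smul] at this
  have hvr : ∀ v, reverse (u : CliffordAlgebra Q) * ι Q (g v) =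
      ι Q v * reverse (u : CliffordAlgebra Q) := fun v => by
    have := congrArg reverse (hv v)
    simpa [reverse.map_mul] using this
  have hru : reverse (u : CliffordAlgebra Q) ∈ even Q :=
    (reverse_mem_evenOdd_iff (Q := Q) (n := 0)).2 hu
  -- `uᵗ u` is central and even, hence a scalar, and can be normalized to `1`.
  obtain ⟨s, hs⟩ := exists_algebraMap_eq_of_commute_even ρ hρ
    (t := reverse (u : CliffordAlgebra Q) * u) (mul_mem hru hu) fun r hr => by
      clear hr
      induction r using CliffordAlgebra.induction with
      | algebraMap r => exact Algebra.commutes _ _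
      | ι v => rw [← mul_assoc, ← hvr, mul_assoc, hv, mul_assoc]
      | mul a b ha hb => rw [mul_assoc, hb, ← mul_assoc, ha, mul_assoc]
      | add a b ha hb => rw [add_mul, mul_add, ha, hb]
  have hs0 : s ≠ 0 := by
    rintro rfl
    rw [map_zero] at hs
    have h1 : reverse (u : CliffordAlgebra Q) = 0 := (Units.mul_left_eq_zero u).mp hs
    have h2 : (u : CliffordAlgebra Q) = 0 := by
      rw [← reverse_reverse (u : CliffordAlgebra Q), h1, map_zero]
    have h4 : (ι Q y : CliffordAlgebra Q) = ι Q 0 := by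
      rw [map_zero, ← one_mul (ι Q y), ← u.inv_mul, h2, mul_zero, zero_mul]
    rw [ι_injective Q h4, QuadraticMap.map_zero] at hy
    exact hy rfl
  obtain ⟨d, hd⟩ := IsAlgClosed.exists_pow_nat_eq s⁻¹ (n := 2) (by norm_num)
  have hd0 : d ≠ 0 := by
    rintro rfl
    exact inv_ne_zero hs0 (by rw [← hd]; simp)
  let γ : (CliffordAlgebra Q)ˣ :=
    Units.map (algebraMap k (CliffordAlgebra Q) : k →* CliffordAlgebra Q) (Units.mk0 d hd0) * u
  have hγ : (γ : CliffordAlgebra Q) = d • (u : CliffordAlgebra Q) := (Algebra.smul_def _ _).symm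
  have hγrev : reverse (γ : CliffordAlgebra Q) * γ = 1 := by
    rw [hγ, map_smul, smul_mul_assoc, mul_smul_comm, smul_smul, ← pow_two, hd, hs,
      Algebra.smul_def, ← map_mul, inv_mul_cancel₀ hs0, map_one]
  have hγv : ∀ v, ι Q (g v) * γ = γ * ι Q v := fun v => by
    rw [hγ, mul_smul_comm, hv, smul_mul_assoc]
  have hγinv : reverse (γ : CliffordAlgebra Q) = ↑γ⁻¹ :=
    (Units.inv_eq_of_mul_eq_one_left hγrev).symm
  have hmem : γ ∈ Spin Q := by
    refine ⟨?_, ?_, fun m => ⟨g m, ?_⟩, fun m => ⟨g.symm m, ?_⟩⟩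
    · rw [hγ]
      exact (even Q).smul_mem hu d
    · rw [hγinv, Units.mul_inv]
    · rw [← hγv, Units.mul_inv_cancel_right]
    · have h := hγv (g.symm m)
      rw [g.apply_symm_apply] at h
      rw [mul_assoc, h, Units.inv_mul_cancel_left]
  refine ⟨⟨γ, hmem⟩, LinearEquiv.ext fun v => ι_injective Q ?_⟩
  rw [ι_proj, ← hγv, Units.mul_inv_cancel_right]

end Lift
end G2Spin

/-! ### Characters of subgroups of `G₂` -/

namespace G2Spin

open CliffordAlgebra

section Character

variable {k : Type*} [Field k] {G : Type*} [Group G] {W : Type*} [AddCommGroup W] [Module k W]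

theorem exists_character_of_eigenvector (ρ : Representation k G W) {w : W} (hw : w ≠ 0)
    (h : ∀ g, ∃ c : k, c ^ 2 = 1 ∧ ρ g w = c • w) :
    ∃ β : G →* kˣ, Occurs β ρ ∧ β ^ 2 = 1 := by
  choose c hc hcw using h
  have hinj : ∀ a b : k, a • w = b • w → a = b := fun a b hab =>
    smul_left_injective k hw hab
  have hmul : ∀ x y, c (x * y) = c x * c y := fun x y => hinj _ _ (by
    rw [← hcw, map_mul, Module.End.mul_apply, hcw y, map_smul, hcw x, smul_smul, mul_comm])
  have hone : c 1 = 1 := hinj _ _ (by rw [← hcw, map_one, one_smul, Module.End.one_apply])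
  let β : G →* kˣ := MonoidHom.toHomUnits { toFun := c, map_one' := hone, map_mul' := hmul }
  exact ⟨β, ⟨w, hw, hcw⟩, MonoidHom.ext fun g => Units.ext (hc g)⟩

end Character

section FixedLine

theorem OctonionAlgebra.apply_e_of_mem_G2 {k C : Type*} [Field k] [AddCommGroup C] [Module k C]
    (O : OctonionAlgebra k C) {φ : C ≃ₗ[k] C} (hφ : φ ∈ O.G2) : φ O.e = O.e := by
  have h : O.mul (φ O.e) (φ (φ.symm O.e)) = φ (φ.symm O.e) := by rw [← hφ, O.e_mul]
  rwa [φ.apply_symm_apply, O.mul_e] at h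

theorem Nondefective.exists_polar_ne_zero {k V : Type*} [Field k] [IsAlgClosed k]
    [AddCommGroup V] [Module k V] {Q : QuadraticForm k V} (hQ : Nondefective Q)
    (hV : 2 ≤ Module.finrank k V) : ∃ x y, QuadraticMap.polar Q x y ≠ 0 := by
  obtain ⟨x, hx0, hx⟩ := exists_isotropic Q hV
  by_contra! h
  exact hx0 (hQ x hx (h x))

variable {k : Type*} [Field k] [IsAlgClosed k] {P : Type*} [AddCommGroup P] [Module k P]
  {Q : QuadraticForm k P}

/-- An element of the spin group lying over an automorphism of the octonions acts on the octonions
as this automorphism up to a sign; in particular it fixes the line of the unit. -/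
theorem exists_sign_cliffordRep_e (hQ : Nondefective Q) (hP : Module.finrank k P = 7)
    {C : Type*} [AddCommGroup C] [Module k C] (O : OctonionAlgebra k C)
    (f : Q.IsometryEquiv (O.norm.comp O.pure.subtype)) {i : k} (hi : i ^ 2 = -1)
    (x : Spin Q) (hx : proj Q x ∈ SO Q) {φ : C ≃ₗ[k] C} (hφ : φ ∈ O.G2)
    (hxφ : ∀ v, ((f (proj Q x v) : O.pure) : C) = φ (f v : O.pure)) :
    ∃ c : k, c ^ 2 = 1 ∧
      O.cliffordRep f.toIsometry hi ((x : (CliffordAlgebra Q)ˣ) : CliffordAlgebra Q) O.e =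
        c • O.e := by
  let σ := O.cliffordRep f.toIsometry hi
  let X : CliffordAlgebra Q := (x : (CliffordAlgebra Q)ˣ)
  have hσι : ∀ v y, σ (ι Q v) y = i • O.mul (f v : O.pure) y := O.cliffordRep_ι f.toIsometry hi
  let Ψ : Module.End k C := φ.symm.toLinearMap
  -- `φ⁻¹ ∘ σ x` commutes with the Clifford algebra, because `σ x` and `φ` intertwine the
  -- multiplication by `v` with the multiplication by `proj x v`.
  have hcomm : ∀ v, Commute (Ψ * σ X) (σ (ι Q v)) := by
    intro v
    refine LinearMap.ext fun y => ?_
    have h1 : σ X (σ (ι Q v) y) = σ (ι Q (proj Q x v)) (σ X y) := by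
      rw [← Module.End.mul_apply, ← map_mul, ← proj_mul, map_mul, Module.End.mul_apply]
    change φ.symm (σ X (σ (ι Q v) y)) = σ (ι Q v) (φ.symm (σ X y))
    rw [h1, φ.symm_apply_eq, hσι, hσι, map_smul, hφ, φ.apply_symm_apply, hxφ]
  have hcomm' : ∀ r, Commute (Ψ * σ X) (σ r) := by
    intro r
    induction r using CliffordAlgebra.induction with
    | algebraMap r => rw [AlgHom.commutes]; exact (Algebra.commutes _ _).symm
    | ι v => exact hcomm v
    | mul a b ha hb => rw [map_mul]; exact ha.mul_right hb
    | add a b ha hb => rw [map_add]; exact ha.add_right hb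
  obtain ⟨c, hc⟩ := exists_eq_smul_one_of_forall_commute (X := Ψ * σ X) fun Y => by
    obtain ⟨r, rfl⟩ := (bijective_even_octonion hi hQ hP O f.toIsometry).2 Y
    exact hcomm' r
  have hσ : ∀ y, σ X y = c • φ y := fun y => by
    have h : φ.symm (σ X y) = c • y := LinearMap.congr_fun hc y
    rw [← map_smul, ← h, φ.apply_symm_apply]
  refine ⟨c, ?_, (hσ O.e).trans (by rw [O.apply_e_of_mem_G2 hφ])⟩
  obtain ⟨v, w, hvw⟩ := hQ.exists_polar_ne_zero (by omega)
  have hf : ∀ a b, QuadraticMap.polar O.norm (f a : O.pure) (f b : O.pure) =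
      QuadraticMap.polar Q a b := fun a b => by
    have h : ∀ a, O.norm (f a : O.pure) = Q a := fun a => f.map_app a
    simp only [QuadraticMap.polar, ← h, map_add, Submodule.coe_add]
  have hg : ∀ a b, QuadraticMap.polar Q (proj Q x a) (proj Q x b) =
      QuadraticMap.polar Q a b := fun a b => by
    simp only [QuadraticMap.polar, ← map_add, hx.1]
  have hrev : reverse X * X = 1 := by
    rw [← Units.inv_eq_of_mul_eq_one_right x.2.2.1, Units.inv_mul]
  have h := O.polar_cliffordRep_of_even f.toIsometry hi x.2.1 hrev (f v : O.pure) (f w : O.pure)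
  change QuadraticMap.polar O.norm (σ X _) (σ X _) = _ at h
  rw [hσ, hσ, ← hxφ, ← hxφ, QuadraticMap.polar_smul_left, QuadraticMap.polar_smul_right, hf, hf,
    hg, smul_eq_mul, smul_eq_mul, ← mul_assoc, ← pow_two] at h
  exact mul_right_cancel₀ hvw (by rw [h, one_mul])

/-- A subgroup of a `G₂`-subgroup has, in its preimage in the spin group, a quadratic character
that occurs in the spin representation: the line of the unit octonion is stable. -/
theorem exists_character_of_le_isG2Subgroup (hQ : Nondefective Q) (hP : Module.finrank k P = 7)
    {W : Type*} [AddCommGroup W] [Module k W] [Module (even Q) W] [IsScalarTower k (even Q) W]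
    [Nontrivial W] (Γ : Subgroup (P ≃ₗ[k] P)) (hΓ : Γ ≤ SO Q) {H : Subgroup (P ≃ₗ[k] P)}
    (hH : IsG2Subgroup Q H) (hΓH : Γ ≤ H) :
    ∃ β : Γ.comap (proj Q) →* kˣ,
      Occurs β ((spinRep Q W).comp (Γ.comap (proj Q)).subtype) ∧ β ^ 2 = 1 := by
  obtain ⟨C, _, _, O, f, hf⟩ := hH
  obtain ⟨i, hi⟩ := IsAlgClosed.exists_pow_nat_eq (-1 : k) (n := 2) (by norm_num)
  have := O.finiteDimensional
  have := O.nontrivial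
  obtain ⟨T, hT, hTσ⟩ := exists_injective_intertwiner _
    (bijective_even_octonion hi hQ hP O f.toIsometry) (Algebra.lsmul k k W)
  refine exists_character_of_eigenvector _ (w := T O.e) (fun h => O.e_ne_zero
    ((map_eq_zero_iff T hT).mp h)) ?_
  rintro ⟨x, hx⟩
  obtain ⟨φ, hφ, hxφ⟩ := (hf _).mp (hΓH hx)
  obtain ⟨c, hc, hce⟩ := exists_sign_cliffordRep_e hQ hP O f hi x (hΓ hx) hφ hxφ
  refine ⟨c, hc, ?_⟩
  rw [← map_smul, ← hce]
  exact (hTσ ⟨_, x.2.1⟩ O.e).symm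

end FixedLine
end G2Spin

/-! ### Isotopes of octonion algebras and the converse -/

namespace G2Spin

open CliffordAlgebra

namespace OctonionAlgebra

variable {k : Type*} [Field k] {C : Type*} [AddCommGroup C] [Module k C]
  (O : OctonionAlgebra k C)

theorem norm_e : O.norm O.e = 1 := by
  obtain ⟨x, y, hxy⟩ : ∃ x y, QuadraticMap.polar O.norm x y ≠ 0 := by
    by_contra! h
    exact O.e_ne_zero (O.nondegenerate.1 _ (h _))
  have h := O.polar_mul_left O.e x y
  rw [O.e_mul, O.e_mul] at h
  exact mul_right_cancel₀ hxy (by rw [one_mul, ← h])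

theorem exists_polar_eq (ℓ : Module.Dual k C) : ∃ u, ∀ x, QuadraticMap.polar O.norm u x = ℓ x := by
  have := O.finiteDimensional
  refine ⟨(LinearMap.BilinForm.toDual O.norm.polarBilin O.nondegenerate).symm ℓ, fun x => ?_⟩
  exact LinearMap.BilinForm.apply_toDual_symm_apply (B := O.norm.polarBilin)
    (hB := O.nondegenerate) ℓ x

/-- Right multiplication by an octonion of norm `1`, as a linear bijection. -/
noncomputable def rightMulEquiv (w : C) (hw : O.norm w = 1) : C ≃ₗ[k] C :=
  have := O.finiteDimensional
  LinearEquiv.ofInjectiveEndo (O.mul.flip w) (by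
    intro x y hxy
    refine O.eq_of_polar_eq fun z => ?_
    have hx := O.polar_mul_right x z w
    have hy := O.polar_mul_right y z w
    rw [hw, mul_one] at hx hy
    rw [← hx, ← hy]
    exact congrArg (fun t => QuadraticMap.polar O.norm t (O.mul z w)) hxy)

theorem rightMulEquiv_apply (w : C) (hw : O.norm w = 1) (x : C) :
    O.rightMulEquiv w hw x = O.mul x w := rfl

theorem norm_rightMulEquiv (w : C) (hw : O.norm w = 1) (x : C) :
    O.norm (O.rightMulEquiv w hw x) = O.norm x := by
  rw [rightMulEquiv_apply, O.norm_mul, hw, mul_one]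

theorem norm_rightMulEquiv_symm (w : C) (hw : O.norm w = 1) (x : C) :
    O.norm ((O.rightMulEquiv w hw).symm x) = O.norm x := by
  rw [← O.norm_rightMulEquiv w hw, LinearEquiv.apply_symm_apply]

/-- The isotope of an octonion algebra in which the octonion `w` of norm `1` is the unit: the
product is characterized by `(x w) ∘ y = x y`. -/
noncomputable def isotope (w : C) (hw : O.norm w = 1) : OctonionAlgebra k C where
  norm := O.norm
  mul := O.mul ∘ₗ (O.rightMulEquiv w hw).symm.toLinearMap
  e := w
  finrank_eq := O.finrank_eq
  nondegenerate := O.nondegenerate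
  norm_mul x y := by
    rw [LinearMap.comp_apply, O.norm_mul]
    congr 1
    exact O.norm_rightMulEquiv_symm w hw x
  e_mul x := by
    have h : (O.rightMulEquiv w hw).symm w = O.e := by
      rw [LinearEquiv.symm_apply_eq, rightMulEquiv_apply, O.e_mul]
    rw [LinearMap.comp_apply, LinearEquiv.coe_coe, h, O.e_mul]
  mul_e x := by
    rw [LinearMap.comp_apply, LinearEquiv.coe_coe, ← O.rightMulEquiv_apply w hw,
      LinearEquiv.apply_symm_apply]

theorem isotope_mul (w : C) (hw : O.norm w = 1) (x y : C) :
    (O.isotope w hw).mul x y = O.mul ((O.rightMulEquiv w hw).symm x) y := rfl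

/-- Right multiplication by `w` carries the pure octonions to the pure octonions of the isotope
with unit `w`. -/
noncomputable def pureIsotopeIsometry (w : C) (hw : O.norm w = 1) :
    (O.norm.comp O.pure.subtype).IsometryEquiv
      ((O.isotope w hw).norm.comp (O.isotope w hw).pure.subtype) where
  toLinearEquiv := (O.rightMulEquiv w hw).ofSubmodules O.pure (O.isotope w hw).pure (by
    have := O.finiteDimensional
    refine Submodule.eq_of_le_of_finrank_eq ?_ ?_
    · rintro _ ⟨x, hx, rfl⟩
      have h : QuadraticMap.polar O.norm O.e x = 0 := hx
      change QuadraticMap.polar O.norm w (O.mul x w) = 0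
      have h' := O.polar_mul_right O.e x w
      rwa [O.e_mul, h, zero_mul] at h'
    · rw [LinearEquiv.finrank_map_eq, finrank_pure, finrank_pure])
  map_app' x := O.norm_rightMulEquiv w hw x

/-- The linearization of `x̄ (x z) = N(x) z`, for a pure octonion and an arbitrary one. -/
theorem pure_mul_add_mul_pure (x : O.pure) (a z : C) :
    O.mul x (O.mul a z) + O.mul a (O.mul x z) =
      QuadraticMap.polar O.norm a O.e • O.mul x z - QuadraticMap.polar O.norm x a • z := by
  refine O.eq_of_polar_eq fun w => ?_
  have h1 := O.polar_mul_add_polar_mul x z a w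
  have h2 := O.polar_pure_mul x w (O.mul a z)
  have h3 := O.polar_mul_add_polar_mul a (O.mul x z) O.e w
  rw [O.e_mul, O.e_mul] at h3
  rw [QuadraticMap.polar_comm O.norm (O.mul x w) (O.mul a z)] at h1 h2
  rw [QuadraticMap.polar_comm O.norm w] at h2
  rw [QuadraticMap.polar_comm O.norm (O.mul a w) (O.mul x z)] at h3
  simp only [QuadraticMap.polar_add_left, QuadraticMap.polar_sub_left,
    QuadraticMap.polar_smul_left, smul_eq_mul]
  linear_combination h3 - h1 + h2

/-- If a linear bijection of the octonions intertwines the left multiplications by `v` and by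
`g v` for all pure octonions `v`, then it intertwines the left multiplication by every octonion with
the left multiplication by some octonion. In characteristic `2` the unit is pure, so that the pure
octonions and the unit do not span, and the hypothesis `hc` is needed: only scalars commute with the
products of two left multiplications by pure octonions. -/
theorem exists_intertwined_mul (F : C ≃ₗ[k] C) (g : O.pure ≃ₗ[k] O.pure)
    (hF : ∀ (v : O.pure) y, F (O.mul v y) = O.mul (g v) (F y))
    (hc : ∀ X : Module.End k C, (∀ v w : O.pure, Commute X (O.mul v * O.mul w)) →
      ∃ c : k, X = c • 1) (a : C) :
    ∃ a', ∀ y, F (O.mul a y) = O.mul a' (F y) := by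
  have := O.finiteDimensional
  have hee : QuadraticMap.polar O.norm O.e O.e = 2 := by
    rw [QuadraticMap.polar_self, O.norm_e]
    norm_num
  by_cases h2 : (2 : k) = 0
  · have he : O.e ∈ O.pure := hee.trans h2
    have hge : (g ⟨O.e, he⟩ : C) = O.e := by
      have h := hF ⟨O.e, he⟩ (F.symm O.e)
      rwa [O.e_mul, F.apply_symm_apply, O.mul_e, eq_comm] at h
    -- The octonion `a'` extends the functional `v ↦ b(v, a)` along `g`; the multiplication by it
    -- conjugates to that by `a` up to an operator that anticommutes with the `v`, and so commutes
    -- with their products.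
    obtain ⟨ℓ, hℓ⟩ := (O.norm.polarBilin a ∘ₗ O.pure.subtype ∘ₗ g.symm.toLinearMap).exists_extend
    obtain ⟨a', ha'⟩ := O.exists_polar_eq ℓ
    have hga : ∀ v, QuadraticMap.polar O.norm a' (g v : O.pure) =
        QuadraticMap.polar O.norm a v := by
      intro v
      have h : ℓ (g v : O.pure) = QuadraticMap.polar O.norm a (g.symm (g v) : O.pure) :=
        LinearMap.congr_fun hℓ (g v)
      rw [ha', h, g.symm_apply_apply]
    have htr : QuadraticMap.polar O.norm a' O.e = QuadraticMap.polar O.norm a O.e := by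
      have h := hga ⟨O.e, he⟩
      rwa [hge] at h
    let X : Module.End k C := F.symm.toLinearMap ∘ₗ (F.toLinearMap ∘ₗ O.mul a -
      O.mul a' ∘ₗ F.toLinearMap)
    have hX : ∀ y, F (X y) = F (O.mul a y) - O.mul a' (F y) := fun y => F.apply_symm_apply _
    have hanti : ∀ (v : O.pure) y, X (O.mul v y) = -O.mul v (X y) := by
      intro v y
      apply F.injective
      have h1 := congrArg F (O.pure_mul_add_mul_pure v a y)
      have h2 := O.pure_mul_add_mul_pure (g v) a' (F y)
      rw [map_add, map_sub, map_smul, map_smul, hF, hF] at h1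
      rw [QuadraticMap.polar_comm O.norm _ a', hga, htr,
        QuadraticMap.polar_comm O.norm a (v : C), ← h1] at h2
      rw [map_neg, hX, hF, hF, hX, map_sub, neg_sub, sub_eq_sub_iff_add_eq_add, h2]
      exact add_comm _ _
    obtain ⟨c, hcX⟩ := hc X fun v w => LinearMap.ext fun y => by
      change X (O.mul v (O.mul w y)) = O.mul v (O.mul w (X y))
      rw [hanti, hanti, map_neg, neg_neg]
    refine ⟨a' + c • O.e, fun y => ?_⟩
    have h := hX y
    rw [hcX, LinearMap.smul_apply, Module.End.one_apply, map_smul, eq_sub_iff_add_eq] at h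
    rw [← h, map_add, LinearMap.add_apply, map_smul, LinearMap.smul_apply, O.e_mul, add_comm]
  · let t := QuadraticMap.polar O.norm O.e a / 2
    have ha : a - t • O.e ∈ O.pure := by
      change QuadraticMap.polar O.norm O.e (a - t • O.e) = 0
      rw [QuadraticMap.polar_sub_right, QuadraticMap.polar_smul_right, hee, smul_eq_mul,
        div_mul_cancel₀ _ h2, sub_self]
    refine ⟨g ⟨_, ha⟩ + t • O.e, fun y => ?_⟩
    have h := hF ⟨_, ha⟩ y
    simp only [map_sub, map_smul, LinearMap.sub_apply, LinearMap.smul_apply, O.e_mul] at h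
    rw [map_add, LinearMap.add_apply, ← h, map_smul, LinearMap.smul_apply, O.e_mul, sub_add_cancel]

end OctonionAlgebra

section G2Subgroup

variable {k : Type u} [Field k] {P : Type v} [AddCommGroup P] [Module k P]
  {Q : QuadraticForm k P}

/-- The `G₂`-subgroup of an octonion algebra and an isometry onto its pure octonions. -/
def g2Subgroup {C : Type w} [AddCommGroup C] [Module k C] (O : OctonionAlgebra k C)
    (f : Q.IsometryEquiv (O.norm.comp O.pure.subtype)) : Subgroup (P ≃ₗ[k] P) where
  carrier := {g | ∃ φ ∈ O.G2, ∀ x : P, ((f (g x) : O.pure) : C) = φ (f x : O.pure)}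
  one_mem' := ⟨1, one_mem _, fun _ => rfl⟩
  mul_mem' := by
    rintro a b ⟨φ, hφ, ha⟩ ⟨ψ, hψ, hb⟩
    exact ⟨φ * ψ, mul_mem hφ hψ, fun x => by
      rw [LinearEquiv.mul_apply, LinearEquiv.mul_apply, ha, hb]⟩
  inv_mem' := by
    rintro a ⟨φ, hφ, ha⟩
    refine ⟨φ⁻¹, inv_mem hφ, fun x => φ.injective ?_⟩
    rw [← ha, ← LinearEquiv.mul_apply, ← LinearEquiv.mul_apply, mul_inv_cancel, mul_inv_cancel]
    rfl

theorem isG2Subgroup_g2Subgroup {C : Type u} [AddCommGroup C] [Module k C]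
    (O : OctonionAlgebra k C) (f : Q.IsometryEquiv (O.norm.comp O.pure.subtype)) :
    IsG2Subgroup Q (g2Subgroup O f) :=
  ⟨C, _, _, O, f, fun _ => Iff.rfl⟩

/-- If an element `x` of the spin group sends the octonion `w` of norm `1` to `±w`, then
`proj x` belongs to the `G₂`-subgroup of the isotope with unit `w`. -/
theorem proj_mem_g2Subgroup_isotope {C : Type w} [AddCommGroup C] [Module k C]
    (O : OctonionAlgebra k C) (f : Q.IsometryEquiv (O.norm.comp O.pure.subtype))
    {i : k} (hi : i ^ 2 = -1)
    (hc : ∀ X : Module.End k C, (∀ v w : O.pure, Commute X (O.mul v * O.mul w)) →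
      ∃ c : k, X = c • 1)
    (w : C) (hw : O.norm w = 1) (x : Spin Q) {c : k} (hc2 : c ^ 2 = 1)
    (hx : O.cliffordRep f.toIsometry hi ((x : (CliffordAlgebra Q)ˣ) : CliffordAlgebra Q) w =
      c • w) :
    proj Q x ∈ g2Subgroup (O.isotope w hw) (f.trans (O.pureIsotopeIsometry w hw)) := by
  let σ := O.cliffordRep f.toIsometry hi
  let X : CliffordAlgebra Q := (x : (CliffordAlgebra Q)ˣ)
  let X' : CliffordAlgebra Q := (↑(x : (CliffordAlgebra Q)ˣ)⁻¹ : CliffordAlgebra Q)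
  have hi0 : i ≠ 0 := by
    rintro rfl
    simp at hi
  have hσι : ∀ v y, σ (ι Q v) y = i • O.mul (f v : O.pure) y := O.cliffordRep_ι f.toIsometry hi
  have hXX' : ∀ y, σ X (σ X' y) = y := fun y => by
    rw [← Module.End.mul_apply, ← map_mul, Units.mul_inv, map_one, Module.End.one_apply]
  have hX'X : ∀ y, σ X' (σ X y) = y := fun y => by
    rw [← Module.End.mul_apply, ← map_mul, Units.inv_mul, map_one, Module.End.one_apply]
  let F : C ≃ₗ[k] C := LinearEquiv.ofLinearMap (c • σ X) (c • σ X')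
    (LinearMap.ext fun y => by
      change c • σ X (c • σ X' y) = y
      rw [map_smul, hXX', smul_smul, ← pow_two, hc2, one_smul])
    (LinearMap.ext fun y => by
      change c • σ X' (c • σ X y) = y
      rw [map_smul, hX'X, smul_smul, ← pow_two, hc2, one_smul])
  have hFap : ∀ y, F y = c • σ X y := fun _ => rfl
  have hFw : F w = w := by
    rw [hFap]
    exact (congrArg _ hx).trans (by rw [smul_smul, ← pow_two, hc2, one_smul])
  let g : O.pure ≃ₗ[k] O.pure :=
    (f.toLinearEquiv.symm.trans (proj Q x)).trans f.toLinearEquiv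
  have hgf : ∀ v, g (f v) = f (proj Q x v) := fun v =>
    congrArg (fun t => f (proj Q x t)) (f.toLinearEquiv.symm_apply_apply v)
  have hFP : ∀ v y, F (O.mul (f v : O.pure) y) = O.mul (f (proj Q x v) : O.pure) (F y) := by
    intro v y
    have h : σ X (σ (ι Q v) y) = σ (ι Q (proj Q x v)) (σ X y) := by
      rw [← Module.End.mul_apply, ← map_mul, ← proj_mul, map_mul, Module.End.mul_apply]
    rw [hσι, hσι, map_smul] at h
    rw [hFap, hFap, map_smul, smul_right_injective C hi0 h]
  have hF : ∀ (v : O.pure) y, F (O.mul v y) = O.mul (g v) (F y) := by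
    intro v y
    obtain ⟨v, rfl⟩ := f.toLinearEquiv.surjective v
    exact (hFP v y).trans (by rw [← hgf]; rfl)
  refine ⟨F, fun a b => ?_, fun v => ?_⟩
  · obtain ⟨a, rfl⟩ := (O.rightMulEquiv w hw).surjective a
    obtain ⟨a', ha'⟩ := O.exists_intertwined_mul F g hF hc a
    rw [O.isotope_mul, O.isotope_mul, LinearEquiv.symm_apply_apply, ha', O.rightMulEquiv_apply, ha',
      hFw, ← O.rightMulEquiv_apply w hw a', LinearEquiv.symm_apply_apply]
  · have h := hFP v w
    rw [hFw] at h
    exact h.symm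

end G2Subgroup

section Converse

variable {k : Type u} [Field k]

/-- In a semisimple representation, every stable line is the image of an equivariant projection. -/
theorem exists_equivariant_functional {G W : Type*} [Group G] [AddCommGroup W] [Module k W]
    (ρ : Representation k G W) (hss : ρ.IsSemisimpleRepresentation) (β : G →* kˣ) {w : W}
    (hw : w ≠ 0) (hρ : ∀ g, ρ g w = (β g : k) • w) :
    ∃ ℓ : Module.Dual k W, ℓ w = 1 ∧ ∀ g x, ℓ (ρ g x) = β g * ℓ x := by
  let L : Subrepresentation ρ :=
    { toSubmodule := Submodule.span k {w}
      apply_mem_toSubmodule := fun g v hv => by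
        obtain ⟨c, rfl⟩ := Submodule.mem_span_singleton.mp hv
        rw [map_smul, hρ]
        exact Submodule.smul_mem _ _
          (Submodule.smul_mem _ _ (Submodule.mem_span_singleton_self w)) }
  obtain ⟨N, hN⟩ := exists_isCompl L
  have hdisj : L.toSubmodule ⊓ N.toSubmodule = ⊥ :=
    congrArg Subrepresentation.toSubmodule hN.inf_eq_bot
  have htop : L.toSubmodule ⊔ N.toSubmodule = ⊤ :=
    congrArg Subrepresentation.toSubmodule hN.sup_eq_top
  have hwN : w ∉ N.toSubmodule := fun h => hw ((Submodule.mem_bot k).mp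
    (hdisj ▸ ⟨Submodule.mem_span_singleton_self w, h⟩))
  obtain ⟨ℓ, hℓw, hℓN⟩ := Submodule.exists_le_ker_of_notMem hwN
  refine ⟨(ℓ w)⁻¹ • ℓ, by simp [hℓw], fun g x => ?_⟩
  obtain ⟨y, hy, n, hn, rfl⟩ := Submodule.mem_sup.mp (htop ▸ Submodule.mem_top (x := x))
  obtain ⟨c, rfl⟩ := Submodule.mem_span_singleton.mp hy
  have h1 : ℓ n = 0 := hℓN hn
  have h2 : ℓ (ρ g n) = 0 := hℓN (N.apply_mem_toSubmodule g hn)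
  simp only [map_add, map_smul, hρ, h1, h2, LinearMap.smul_apply, smul_eq_mul]
  ring

variable [IsAlgClosed k] {P : Type v} [AddCommGroup P] [Module k P] {Q : QuadraticForm k P}

/-- If a group acts on an octonion algebra preserving the polar form of the norm, and a line on
which it acts by signs has an equivariant projection, then it acts by the same signs on an octonion
of norm `1`. -/
theorem OctonionAlgebra.exists_eigenvector_norm_eq_one {C G : Type*} [AddCommGroup C] [Module k C]
    [Group G] (O : OctonionAlgebra k C) (τ : Representation k G C)
    (hτ : ∀ g x y, QuadraticMap.polar O.norm (τ g x) (τ g y) = QuadraticMap.polar O.norm x y)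
    (β : G → k) (hβ : ∀ g, β g ^ 2 = 1) {w : C} (hw : ∀ g, τ g w = β g • w)
    {ℓ : Module.Dual k C} (hℓw : ℓ w = 1) (hℓ : ∀ g x, ℓ (τ g x) = β g * ℓ x) :
    ∃ w', O.norm w' = 1 ∧ ∀ g, τ g w' = β g • w' := by
  -- The vector representing the projection is an eigenvector that is not orthogonal to `w`.
  obtain ⟨u, hu⟩ := O.exists_polar_eq ℓ
  have huτ : ∀ g, τ g u = β g • u := by
    intro g
    refine O.eq_of_polar_eq fun y => ?_
    have hy : τ g (τ g⁻¹ y) = y := by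
      rw [← Module.End.mul_apply, ← map_mul, mul_inv_cancel, map_one, Module.End.one_apply]
    have h := hℓ g (τ g⁻¹ y)
    rw [hy] at h
    rw [← hy, hτ, hy, hu, QuadraticMap.polar_smul_left, hu, h, smul_eq_mul, ← mul_assoc, ← pow_two,
      hβ, one_mul]
  obtain ⟨s, hs0, hs⟩ : ∃ s, O.norm s ≠ 0 ∧ ∀ g, τ g s = β g • s := by
    by_cases hu0 : O.norm u = 0
    · by_cases hw0 : O.norm w = 0
      · refine ⟨u + w, ?_, fun g => by rw [map_add, huτ, hw, smul_add]⟩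
        rw [QuadraticMap.map_add O.norm, hu0, hw0, hu, hℓw]
        simp
      · exact ⟨w, hw0, hw⟩
    · exact ⟨u, hu0, huτ⟩
  obtain ⟨d, hd⟩ := IsAlgClosed.exists_pow_nat_eq (O.norm s)⁻¹ (n := 2) (by norm_num)
  refine ⟨d • s, ?_, fun g => by rw [map_smul, hs, smul_comm]⟩
  rw [QuadraticMap.map_smul, ← pow_two, hd, smul_eq_mul, inv_mul_cancel₀ hs0]

/-- If the spin representation of the preimage of `Γ` is semisimple and contains a quadratic
character, then `Γ` lies in a `G₂`-subgroup. -/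
theorem exists_isG2Subgroup_of_occurs (hQ : Nondefective Q) (hP : Module.finrank k P = 7)
    {W : Type w} [AddCommGroup W] [Module k W] [Module (even Q) W] [IsScalarTower k (even Q) W]
    [IsSimpleModule (even Q) W] (Γ : Subgroup (P ≃ₗ[k] P)) (hΓ : Γ ≤ SO Q)
    (hss : Representation.IsSemisimpleRepresentation
      ((spinRep Q W).comp (Γ.comap (proj Q)).subtype))
    (β : Γ.comap (proj Q) →* kˣ)
    (hβ : Occurs β ((spinRep Q W).comp (Γ.comap (proj Q)).subtype)) (hβ2 : β ^ 2 = 1) :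
    ∃ H : Subgroup (P ≃ₗ[k] P), IsG2Subgroup Q H ∧ Γ ≤ H := by
  obtain ⟨f⟩ := hQ.nonempty_isometryEquiv_pure_splitOctonion hP
  obtain ⟨i, hi⟩ := IsAlgClosed.exists_pow_nat_eq (-1 : k) (n := 2) (by norm_num)
  have : FiniteDimensional k P := Module.finite_of_finrank_pos (by omega)
  have : Nontrivial W := IsSimpleModule.nontrivial (even Q) W
  let O := splitOctonion k
  let σ := O.cliffordRep f.toIsometry hi
  have hbij := bijective_even_splitOctonion hi f
  obtain ⟨T, hT, hTσ⟩ := exists_injective_intertwiner _ hbij (Algebra.lsmul k k W)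
  have hTσ' : ∀ (r : even Q) v, T (σ r v) = r • T v := hTσ
  obtain ⟨w, hw0, hw⟩ := hβ
  -- The spinor module is simple, hence isomorphic to the split octonions.
  have hTsurj : Function.Surjective T := by
    let R : Submodule (even Q) W :=
      { LinearMap.range T with
        smul_mem' := by
          rintro r _ ⟨v, rfl⟩
          exact ⟨σ r v, hTσ' r v⟩ }
    have hR : R = ⊤ := (eq_bot_or_eq_top R).resolve_left fun h => by
      obtain ⟨v, hv⟩ := exists_ne (0 : Fin 8 → k)
      have hmem : T v ∈ R := ⟨v, rfl⟩
      rw [h, Submodule.mem_bot] at hmem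
      exact hv ((map_eq_zero_iff T hT).mp hmem)
    intro y
    have hy : y ∈ R := hR ▸ Submodule.mem_top
    exact hy
  obtain ⟨ℓ, hℓw, hℓ⟩ := exists_equivariant_functional _ hss β hw0 hw
  obtain ⟨w, rfl⟩ := hTsurj w
  let τ : Representation k (Γ.comap (proj Q)) (Fin 8 → k) :=
    (((σ : CliffordAlgebra Q →* Module.End k (Fin 8 → k)).comp
      (Units.coeHom (CliffordAlgebra Q))).comp (Spin Q).subtype).comp (Γ.comap (proj Q)).subtype
  have hτap : ∀ x v, τ x v =
      σ (((x : Spin Q) : (CliffordAlgebra Q)ˣ) : CliffordAlgebra Q) v := fun _ _ => rfl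
  have hTτ : ∀ x v, T (τ x v) = ((spinRep Q W).comp (Γ.comap (proj Q)).subtype) x (T v) :=
    fun x v => hTσ ⟨_, x.1.2.1⟩ v
  obtain ⟨w₁, hw₁, hw₁τ⟩ := O.exists_eigenvector_norm_eq_one τ
    (fun x y z => O.polar_cliffordRep_of_even f.toIsometry hi x.1.2.1
      (by rw [← Units.inv_eq_of_mul_eq_one_right x.1.2.2.1, Units.inv_mul]) y z)
    (fun x => (β x : k)) (fun x => congrArg Units.val (DFunLike.congr_fun hβ2 x))
    (w := w) (fun x => hT (by rw [hTτ, hw, map_smul])) (ℓ := ℓ ∘ₗ T) hℓw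
    (fun x v => by rw [LinearMap.comp_apply, hTτ, hℓ, LinearMap.comp_apply])
  refine ⟨_, isG2Subgroup_g2Subgroup (O.isotope w₁ hw₁) (f.trans (O.pureIsotopeIsometry w₁ hw₁)),
    fun g hg => ?_⟩
  obtain ⟨y, z, hyz⟩ := hQ.exists_polar_ne_zero (by omega)
  obtain ⟨y, hy⟩ : ∃ y, Q y ≠ 0 := by
    by_contra! h
    exact hyz (by simp [QuadraticMap.polar, h])
  obtain ⟨x, rfl⟩ := exists_spin_proj_eq σ (by rw [hP]; decide) hbij y hy g (hΓ hg)
  exact proj_mem_g2Subgroup_isotope O f hi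
    (fun X hX => exists_eq_smul_one_of_commute_pure fun a ha b hb => hX ⟨a, ha⟩ ⟨b, hb⟩) w₁ hw₁ x
    (c := β ⟨x, hg⟩) (congrArg Units.val (DFunLike.congr_fun hβ2 _)) (hw₁τ ⟨x, hg⟩)

end Converse

end G2Spin

theorem mainTheorem10 {k : Type u} [Field k] [IsAlgClosed k]
    {P : Type v} [AddCommGroup P] [Module k P] (hdim : Module.finrank k P = 7)
    (Q : QuadraticForm k P) (hQ : G2Spin.IsRegular Q)
    (W : Type w) [AddCommGroup W] [Module k W] [Module (CliffordAlgebra.even Q) W]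
    [IsScalarTower k (CliffordAlgebra.even Q) W] [IsSimpleModule (CliffordAlgebra.even Q) W]
    (Γ : Subgroup (P ≃ₗ[k] P)) (hΓ : Γ ≤ G2Spin.SO Q)
    (hss : Representation.IsSemisimpleRepresentation
      ((G2Spin.spinRep Q W).comp (Γ.comap (G2Spin.proj Q)).subtype)) :
    (∃ H : Subgroup (P ≃ₗ[k] P), G2Spin.IsG2Subgroup Q H ∧ Γ ≤ H) ↔
      ∃ β : Γ.comap (G2Spin.proj Q) →* kˣ,
        G2Spin.Occurs β ((G2Spin.spinRep Q W).comp (Γ.comap (G2Spin.proj Q)).subtype) ∧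
          β ^ 2 = 1 := by
  have : Nontrivial W := IsSimpleModule.nontrivial (CliffordAlgebra.even Q) W
  constructor
  · rintro ⟨H, hH, hΓH⟩
    exact G2Spin.exists_character_of_le_isG2Subgroup hQ.nondefective hdim Γ hΓ hH hΓH
  · rintro ⟨β, hβ, hβ2⟩
    exact G2Spin.exists_isG2Subgroup_of_occurs hQ.nondefective hdim Γ hΓ hss β hβ hβ2
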